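/- Let $N\ge 0$ be an integer. Let $A_u^*(N)$ be the universal unital $C^*$-algebra generated by elements $u_{ij}$ ($1\le i,j\le N$) such that the matrix $u=(u_{ij})$ and its transpose $u^t$ are both unitary and $$ab^*c=cb^*a\qquad\text{for all } a,b,c\in\{u_{ij}: 1\le i,j\le N\},$$ with the coproduct $\Delta:A_u^*(N)\to A_u^*(N)\otimes A_u^*(N)$ (minimal tensor product) determined by $\Delta(u_{ij})=\sum_k u_{ik}\otimes u_{kj}$. Let $PA_u^*(N)$, the projective version of $A_u^*(N)$, be the closed unital $*$-subalgebra of $A_u^*(N)$ generated by the products $u_{ij}^*u_{kl}$ ($1\le i,j,k,l\le N$). Let $PU(N)=U(N)/U(1)$ be the projective unitary group (the quotient of $U(N)$ by its scalar matrices), and equip $C(PU(N))$ with the coproduct $(\Delta_{PU(N)}f)(g,h)=f(gh)$, where $C(PU(N))\otimes C(PU(N))$ is identified with $C(PU(N)\times PU(N))$. Then the $C^*$-algebra $PA_u^*(N)$ is commutative, the coproduct $\Delta$ restricts to a unital $*$-homomorphism $\Delta':PA_u^*(N)\to PA_u^*(N)\otimes PA_u^*(N)$ (that is, $(\iota\otimes\iota)\circ\Delta'=\Delta\circ\iota$,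 where $\iota:PA_u^*(N)\to A_u^*(N)$ is the inclusion), and with this coproduct $PA_u^*(N)$ is isomorphic to $C(PU(N))$ as a compact quantum group: there is a $*$-isomorphism $\Phi:PA_u^*(N)\to C(PU(N))$ such that $\Delta_{PU(N)}\circ\Phi=(\Phi\otimes\Phi)\circ\Delta'$. -/

import Mathlib

noncomputable section

open scoped TensorProduct ComplexOrder

/-! ### C*-seminorms and C*-completions of *-algebras -/

/-- A C*-seminorm on a unital complex *-algebra `F`: a submultiplicative seminorm `p` with
`p (x* x) = p x ^ 2`. -/
structure CStarSeminorm (F : Type*) [Ring F] [StarRing F] [Algebra ℂ F] [StarModule ℂ F] extends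
    Seminorm ℂ F where
  mul_le' : ∀ x y, toFun (x * y) ≤ toFun x * toFun y
  star_mul_self' : ∀ x, toFun (star x * x) = toFun x ^ 2

namespace CStarSeminorm

variable {F : Type*} [Ring F] [StarRing F] [Algebra ℂ F] [StarModule ℂ F]

instance : CoeFun (CStarSeminorm F) (fun _ => F → ℝ) := ⟨fun p => p.toSeminorm⟩

variable (p : CStarSeminorm F)

lemma mul_le (x y : F) : p (x * y) ≤ p x * p y := p.mul_le' x y

lemma star_mul_self (x : F) : p (star x * x) = p x ^ 2 := p.star_mul_self' x

protected lemma map_star' (x : F) : p (star x) = p x := by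
  have key : ∀ y : F, p y ≤ p (star y) := fun y => by
    have h1 := p.star_mul_self y
    have h2 := p.mul_le (star y) y
    rcases (apply_nonneg p.toSeminorm y).eq_or_lt with h | h
    · rw [← h]; exact apply_nonneg p.toSeminorm _
    · nlinarith
  exact le_antisymm (by simpa using key (star x)) (key x)

/-- The *-algebra `F` itself, viewed as a seminormed algebra through `p`. -/
def Pre (_p : CStarSeminorm F) : Type _ := F

instance : Ring p.Pre := inferInstanceAs (Ring F)
instance : StarRing p.Pre := inferInstanceAs (StarRing F)
instance : Algebra ℂ p.Pre := inferInstanceAs (Algebra ℂ F)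
instance : StarModule ℂ p.Pre := inferInstanceAs (StarModule ℂ F)

instance : SeminormedAddCommGroup p.Pre :=
  AddGroupSeminorm.toSeminormedAddCommGroup (E := p.Pre)
    { toFun := fun x => p.toSeminorm (show F from x)
      map_zero' := map_zero p.toSeminorm
      add_le' := fun x y => map_add_le_add p.toSeminorm (show F from x) (show F from y)
      neg' := fun x => map_neg_eq_map p.toSeminorm (show F from x) }

/-- The identity map from `F` to its seminormed copy. -/
def toPre : F →⋆ₐ[ℂ] p.Pre := StarAlgHom.id ℂ F

lemma norm_toPre (x : F) : ‖p.toPre x‖ = p x := rfl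

instance : SeminormedRing p.Pre where
  __ := (inferInstance : SeminormedAddCommGroup p.Pre)
  __ := (inferInstance : Ring p.Pre)
  norm_mul_le x y := p.mul_le x y

instance : NormedAlgebra ℂ p.Pre where
  __ := (inferInstance : Algebra ℂ p.Pre)
  norm_smul_le c x := (map_smul_eq_mul p.toSeminorm c x).le

instance : NormedStarGroup p.Pre where
  norm_star_le x := (p.map_star' x).le

/-- The Hausdorff completion of `F` with respect to the C*-seminorm `p`. -/
def CStarCompletion : Type _ := UniformSpace.Completion p.Pre

instance : NormedRing p.CStarCompletion :=
  inferInstanceAs (NormedRing (UniformSpace.Completion p.Pre))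

instance : Algebra ℂ p.CStarCompletion :=
  inferInstanceAs (Algebra ℂ (UniformSpace.Completion p.Pre))

instance : NormedAlgebra ℂ p.CStarCompletion where
  __ := (inferInstance : Algebra ℂ p.CStarCompletion)
  norm_smul_le := norm_smul_le (α := ℂ) (β := UniformSpace.Completion p.Pre)

instance : CompleteSpace p.CStarCompletion :=
  inferInstanceAs (CompleteSpace (UniformSpace.Completion p.Pre))

/-- The canonical map `F → F^`, as a plain function; see `coe` for the *-homomorphism. -/
def coeFun (x : F) : p.CStarCompletion := ((p.toPre x : p.Pre) : UniformSpace.Completion p.Pre)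

lemma denseRange_coeFun : DenseRange p.coeFun :=
  UniformSpace.Completion.denseRange_coe (α := p.Pre)

@[elab_as_elim]
lemma induction_on {P : p.CStarCompletion → Prop} (y : p.CStarCompletion)
    (hc : IsClosed {y | P y}) (h : ∀ x : F, P (p.coeFun x)) : P y :=
  p.denseRange_coeFun.induction_on y hc h

@[elab_as_elim]
lemma induction_on₂ {P : p.CStarCompletion → p.CStarCompletion → Prop} (y z : p.CStarCompletion)
    (hc : IsClosed {w : p.CStarCompletion × p.CStarCompletion | P w.1 w.2})
    (h : ∀ a b : F, P (p.coeFun a) (p.coeFun b)) : P y z :=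
  UniformSpace.Completion.induction_on₂ (α := p.Pre) (β := p.Pre) y z hc h

lemma coeFun_add (x y : F) : p.coeFun (x + y) = p.coeFun x + p.coeFun y :=
  UniformSpace.Completion.coe_add (α := p.Pre) _ _

lemma coeFun_mul (x y : F) : p.coeFun (x * y) = p.coeFun x * p.coeFun y :=
  UniformSpace.Completion.coe_mul (α := p.Pre) _ _

lemma coeFun_smul (c : ℂ) (x : F) : p.coeFun (c • x) = c • p.coeFun x :=
  UniformSpace.Completion.coe_smul (X := p.Pre) c (p.toPre x)

lemma coeFun_one : p.coeFun (1 : F) = 1 :=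
  UniformSpace.Completion.coe_one (α := p.Pre)

lemma norm_coeFun (x : F) : ‖p.coeFun x‖ = p x :=
  UniformSpace.Completion.norm_coe (E := p.Pre) _

instance : Star p.CStarCompletion := ⟨UniformSpace.Completion.map (star : p.Pre → p.Pre)⟩

lemma star_coeFun (x : F) : star (p.coeFun x) = p.coeFun (star x) :=
  UniformSpace.Completion.map_coe (star_isometry (E := p.Pre)).uniformContinuous _

instance : ContinuousStar p.CStarCompletion :=
  ⟨UniformSpace.Completion.continuous_map (f := (star : p.Pre → p.Pre))⟩

instance : StarRing p.CStarCompletion where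
  star_involutive y := by
    induction y using p.induction_on with
    | hc => exact isClosed_eq (by fun_prop) (by fun_prop)
    | h x => simp [star_coeFun]
  star_mul y z := by
    induction y, z using p.induction_on₂ with
    | hc => exact isClosed_eq (by fun_prop) (by fun_prop)
    | h x => simp [star_coeFun, ← coeFun_mul]
  star_add y z := by
    induction y, z using p.induction_on₂ with
    | hc => exact isClosed_eq (by fun_prop) (by fun_prop)
    | h x => simp [star_coeFun, ← coeFun_add]

instance : CStarRing p.CStarCompletion where
  norm_mul_self_le y := by
    induction y using p.induction_on with
    | hc => exact isClosed_le (by fun_prop) (by fun_prop)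
    | h x => rw [star_coeFun, ← coeFun_mul, norm_coeFun, norm_coeFun, star_mul_self, sq]

instance : StarModule ℂ p.CStarCompletion where
  star_smul c y := by
    induction y using p.induction_on with
    | hc => exact isClosed_eq (continuous_star.comp (continuous_const_smul c))
              ((continuous_const_smul (star c)).comp continuous_star)
    | h x => rw [← coeFun_smul, star_coeFun, star_coeFun, ← coeFun_smul, star_smul]

instance : CStarAlgebra p.CStarCompletion where

/-- The canonical *-homomorphism from `F` to its C*-completion. -/
def coe : F →⋆ₐ[ℂ] p.CStarCompletion where
  toFun := p.coeFun
  map_one' := p.coeFun_one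
  map_mul' := p.coeFun_mul
  map_zero' := by simpa using p.coeFun_smul 0 0
  map_add' := p.coeFun_add
  commutes' c := by
    rw [Algebra.algebraMap_eq_smul_one, coeFun_smul, coeFun_one, Algebra.algebraMap_eq_smul_one]
  map_star' x := (p.star_coeFun x).symm

lemma norm_coe (x : F) : ‖p.coe x‖ = p x := p.norm_coeFun x

lemma denseRange_coe : DenseRange p.coe := p.denseRange_coeFun

lemma coe_eq_zero_iff (x : F) : p.coe x = 0 ↔ p x = 0 := by
  rw [← norm_eq_zero, norm_coe]

variable {B : Type*} [CStarAlgebra B]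

/-- *-homomorphisms out of the C*-completion agree if they agree on `F`. -/
lemma hom_ext {f g : p.CStarCompletion →⋆ₐ[ℂ] B} (hf : Continuous f) (hg : Continuous g)
    (h : ∀ x, f (p.coe x) = g (p.coe x)) : f = g := by
  ext y
  induction y using p.induction_on with
  | hc => exact isClosed_eq hf hg
  | h x => exact h x

/-- A *-homomorphism out of `F`, read on the seminormed copy of `F` (auxiliary). -/
def preHom (f : F →⋆ₐ[ℂ] B) : p.Pre →+* B := RingHomClass.toRingHom (α := F) f

lemma continuous_preHom (f : F →⋆ₐ[ℂ] B) (hf : ∀ x, ‖f x‖ ≤ p x) : Continuous (p.preHom f) :=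
  AddMonoidHomClass.continuous_of_bound (p.preHom f) 1 fun x => by rw [one_mul]; exact hf x

/-- The extension to the completion as a ring homomorphism (auxiliary). -/
def liftRingHom (f : F →⋆ₐ[ℂ] B) (hf : ∀ x, ‖f x‖ ≤ p x) : p.CStarCompletion →+* B :=
  UniformSpace.Completion.extensionHom (p.preHom f) (p.continuous_preHom f hf)

lemma liftRingHom_coeFun (f : F →⋆ₐ[ℂ] B) (hf : ∀ x, ‖f x‖ ≤ p x) (x : F) :
    p.liftRingHom f hf (p.coeFun x) = f x :=
  UniformSpace.Completion.extensionHom_coe (p.preHom f) (p.continuous_preHom f hf) (p.toPre x)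

lemma continuous_liftRingHom (f : F →⋆ₐ[ℂ] B) (hf : ∀ x, ‖f x‖ ≤ p x) :
    Continuous (p.liftRingHom f hf) :=
  UniformSpace.Completion.continuous_extension

/-- Extension by continuity of a *-homomorphism bounded by `p` to the C*-completion. -/
def lift (f : F →⋆ₐ[ℂ] B) (hf : ∀ x, ‖f x‖ ≤ p x) : p.CStarCompletion →⋆ₐ[ℂ] B where
  __ := p.liftRingHom f hf
  commutes' c := by
    change p.liftRingHom f hf _ = _
    rw [← AlgHomClass.commutes p.coe c, ← AlgHomClass.commutes f c]
    exact p.liftRingHom_coeFun f hf _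
  map_star' y := by
    change p.liftRingHom f hf _ = star (p.liftRingHom f hf _)
    have := p.continuous_liftRingHom f hf
    induction y using p.induction_on with
    | hc => exact isClosed_eq (by fun_prop) (by fun_prop)
    | h x => rw [star_coeFun, liftRingHom_coeFun, liftRingHom_coeFun, map_star]

lemma lift_coe (f : F →⋆ₐ[ℂ] B) (hf : ∀ x, ‖f x‖ ≤ p x) (x : F) : p.lift f hf (p.coe x) = f x :=
  p.liftRingHom_coeFun f hf x

lemma continuous_lift (f : F →⋆ₐ[ℂ] B) (hf : ∀ x, ‖f x‖ ≤ p x) : Continuous (p.lift f hf) :=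
  p.continuous_liftRingHom f hf

/-- The C*-seminorm `x ↦ ‖f x‖` induced by a *-homomorphism `f` into a C*-algebra. -/
def ofHom (f : F →⋆ₐ[ℂ] B) : CStarSeminorm F where
  toFun x := ‖f x‖
  map_zero' := by simp
  add_le' x y := by simpa using norm_add_le (f x) (f y)
  neg' x := by simp
  smul' c x := by simp [norm_smul]
  mul_le' x y := by simpa using norm_mul_le (f x) (f y)
  star_mul_self' x := by simp [map_star, CStarRing.norm_star_mul_self, sq]

@[simp] lemma ofHom_apply (f : F →⋆ₐ[ℂ] B) (x : F) : ofHom f x = ‖f x‖ := rfl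

/-- The pointwise supremum of a pointwise bounded set of C*-seminorms
(the zero seminorm if the set is empty). -/
def sup (S : Set (CStarSeminorm F)) (hS : ∀ x, ∃ C, ∀ p ∈ S, p x ≤ C) : CStarSeminorm F :=
  have bdd : ∀ x, BddAbove (Set.range fun p : S => p.1 x) := fun x =>
    let ⟨C, hC⟩ := hS x
    ⟨C, by rintro _ ⟨p, rfl⟩; exact hC p.1 p.2⟩
  have nn : ∀ x, 0 ≤ ⨆ p : S, p.1 x := fun x =>
    Real.iSup_nonneg fun p => apply_nonneg p.1.toSeminorm x
  { toFun := fun x => ⨆ p : S, p.1 x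
    map_zero' := by simp
    add_le' := fun x y => Real.iSup_le (fun p => (map_add_le_add p.1.toSeminorm x y).trans
      (add_le_add (le_ciSup (bdd x) p) (le_ciSup (bdd y) p))) (add_nonneg (nn x) (nn y))
    neg' := fun x => by simp
    smul' := fun c x => by
      simp only [map_smul_eq_mul]
      rw [Real.mul_iSup_of_nonneg (norm_nonneg c)]
    mul_le' := fun x y => Real.iSup_le (fun p => (p.1.mul_le x y).trans
      (mul_le_mul (le_ciSup (bdd x) p) (le_ciSup (bdd y) p)
        (apply_nonneg p.1.toSeminorm y) (nn x))) (mul_nonneg (nn x) (nn y))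
    star_mul_self' := fun x => by
      simp only [star_mul_self]
      rcases isEmpty_or_nonempty S with h | h
      · simp
      · exact (Real.iSup_pow (fun p : S => apply_nonneg p.1.toSeminorm x) 2).symm }

variable {S : Set (CStarSeminorm F)} {hS : ∀ x, ∃ C, ∀ p ∈ S, p x ≤ C}

lemma le_sup {p : CStarSeminorm F} (hp : p ∈ S) (x : F) : p x ≤ sup S hS x := by
  obtain ⟨C, hC⟩ := hS x
  exact le_ciSup (f := fun p : S => p.1 x)
    ⟨C, by rintro _ ⟨q, rfl⟩; exact hC q.1 q.2⟩ (⟨p, hp⟩ : S)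

lemma sup_le {x : F} {C : ℝ} (hC : 0 ≤ C) (h : ∀ p ∈ S, p x ≤ C) : sup S hS x ≤ C :=
  Real.iSup_le (fun p => h p.1 p.2) hC

end CStarSeminorm

/-! ### The free *-algebra and universal C*-algebras -/

/-- The free unital complex *-algebra on the set `X`: the free algebra on the letters
`x` (`Sum.inl x`) and `x*` (`Sum.inr x`), `x ∈ X`. -/
def FreeStarAlgebra (X : Type*) : Type _ := FreeAlgebra ℂ (X ⊕ X)

namespace FreeStarAlgebra

variable {X : Type*}

instance : Ring (FreeStarAlgebra X) := inferInstanceAs (Ring (FreeAlgebra ℂ (X ⊕ X)))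
instance : Algebra ℂ (FreeStarAlgebra X) := inferInstanceAs (Algebra ℂ (FreeAlgebra ℂ (X ⊕ X)))

/-- A letter of the free *-algebra. -/
def letter (y : X ⊕ X) : FreeStarAlgebra X := FreeAlgebra.ι ℂ y

/-- The generator attached to `x`. -/
def gen (x : X) : FreeStarAlgebra X := letter (Sum.inl x)

/-- The universal property of the free algebra on the letters (auxiliary). -/
def liftAlg {B : Type*} [Ring B] [Algebra ℂ B] (f : X ⊕ X → B) : FreeStarAlgebra X →ₐ[ℂ] B :=
  FreeAlgebra.lift ℂ f

lemma liftAlg_letter {B : Type*} [Ring B] [Algebra ℂ B] (f : X ⊕ X → B) (y : X ⊕ X) :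
    liftAlg f (letter y) = f y := FreeAlgebra.lift_ι_apply f y

@[elab_as_elim]
lemma induction_letter {P : FreeStarAlgebra X → Prop} (a : FreeStarAlgebra X)
    (hs : ∀ c : ℂ, P (algebraMap ℂ _ c)) (hl : ∀ y, P (letter y))
    (hm : ∀ a b, P a → P b → P (a * b)) (ha : ∀ a b, P a → P b → P (a + b)) : P a :=
  FreeAlgebra.induction ℂ (X ⊕ X) (motive := P) hs hl hm ha a

/-- The opposite algebra, with the conjugate scalar multiplication (auxiliary). -/
abbrev conjAlgebra : Algebra ℂ (FreeStarAlgebra X)ᵐᵒᵖ :=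
  RingHom.toAlgebra' ((algebraMap ℂ (FreeStarAlgebra X)ᵐᵒᵖ).comp (starRingEnd ℂ))
    fun c x => Algebra.commutes (starRingEnd ℂ c) x

/-- The involution as a ring homomorphism into the opposite algebra: it is conjugate linear on
scalars and exchanges the letters `x` and `x*` (auxiliary). -/
def starHom : FreeStarAlgebra X →+* (FreeStarAlgebra X)ᵐᵒᵖ :=
  letI : Algebra ℂ (FreeStarAlgebra X)ᵐᵒᵖ := conjAlgebra
  (liftAlg (B := (FreeStarAlgebra X)ᵐᵒᵖ) fun y => MulOpposite.op (letter y.swap)).toRingHom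

lemma starHom_letter (y : X ⊕ X) :
    starHom (letter y) = MulOpposite.op (letter (X := X) y.swap) :=
  letI : Algebra ℂ (FreeStarAlgebra X)ᵐᵒᵖ := conjAlgebra
  liftAlg_letter (B := (FreeStarAlgebra X)ᵐᵒᵖ) (fun y => MulOpposite.op (letter y.swap)) y

lemma starHom_scalar (c : ℂ) :
    starHom (algebraMap ℂ (FreeStarAlgebra X) c) =
      MulOpposite.op (algebraMap ℂ (FreeStarAlgebra X) (star c)) :=
  (@AlgHom.commutes ℂ (FreeStarAlgebra X) (FreeStarAlgebra X)ᵐᵒᵖ _ _ _ _ conjAlgebra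
    (@liftAlg X (FreeStarAlgebra X)ᵐᵒᵖ _ conjAlgebra
      fun y => MulOpposite.op (letter y.swap)) c).trans rfl

instance : Star (FreeStarAlgebra X) := ⟨fun a => (starHom a).unop⟩

lemma star_def (a : FreeStarAlgebra X) : star a = (starHom a).unop := rfl

lemma star_letter (y : X ⊕ X) : star (letter y) = letter (X := X) y.swap := by
  rw [star_def, starHom_letter, MulOpposite.unop_op]

lemma star_gen (x : X) : star (gen x) = letter (Sum.inr x) := star_letter _

instance : StarRing (FreeStarAlgebra X) where
  star_mul a b := by simp [star_def]
  star_add a b := by simp [star_def]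
  star_involutive a := by
    induction a using induction_letter with
    | hs c => simp [star_def, starHom_scalar]
    | hl y => simp [star_letter]
    | hm a b ha hb =>
      have h : star (star (a * b)) = star (star a) * star (star b) := by simp [star_def]
      rw [h, ha, hb]
    | ha a b ha hb =>
      have h : star (star (a + b)) = star (star a) + star (star b) := by simp [star_def]
      rw [h, ha, hb]

lemma star_scalar (c : ℂ) :
    star (algebraMap ℂ (FreeStarAlgebra X) c) = algebraMap ℂ (FreeStarAlgebra X) (star c) := by
  rw [star_def, starHom_scalar, MulOpposite.unop_op]

instance : StarModule ℂ (FreeStarAlgebra X) where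
  star_smul c a := by
    rw [Algebra.smul_def, star_mul, star_scalar, ← Algebra.commutes, Algebra.smul_def]

@[elab_as_elim]
lemma induction {P : FreeStarAlgebra X → Prop} (a : FreeStarAlgebra X)
    (hs : ∀ c : ℂ, P (algebraMap ℂ _ c)) (hg : ∀ x, P (gen x)) (hg' : ∀ x, P (star (gen x)))
    (hm : ∀ a b, P a → P b → P (a * b)) (ha : ∀ a b, P a → P b → P (a + b)) : P a := by
  induction a using induction_letter with
  | hs c => exact hs c
  | hl y =>
    rcases y with x | x
    · exact hg x
    · exact star_gen x ▸ hg' x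
  | hm a b ha hb => exact hm a b ha hb
  | ha a b h h' => exact ha a b h h'

section lift

variable {B : Type*} [Ring B] [StarRing B] [Algebra ℂ B] [StarModule ℂ B]

/-- The universal property of the free *-algebra: a map `f : X → B` into a *-algebra extends to a
*-homomorphism. -/
def lift (f : X → B) : FreeStarAlgebra X →⋆ₐ[ℂ] B where
  __ := liftAlg (Sum.elim f fun x => star (f x))
  map_star' a := by
    change liftAlg _ (star a) = star (liftAlg _ a)
    induction a using induction_letter with
    | hs c => rw [star_scalar, AlgHom.commutes, AlgHom.commutes, algebraMap_star_comm]
    | hl y =>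
      rw [star_letter, liftAlg_letter, liftAlg_letter]
      rcases y with x | x <;> simp
    | hm a b ha hb => rw [star_mul, map_mul, map_mul, star_mul, ha, hb]
    | ha a b ha hb => rw [star_add, map_add, map_add, star_add, ha, hb]

@[simp] lemma lift_gen (f : X → B) (x : X) : lift f (gen x) = f x :=
  liftAlg_letter _ _

end lift

lemma hom_ext {B : Type*} [Ring B] [StarRing B] [Algebra ℂ B]
    {f g : FreeStarAlgebra X →⋆ₐ[ℂ] B} (h : ∀ x, f (gen x) = g (gen x)) : f = g := by
  ext a
  induction a using induction with
  | hs c => rw [AlgHomClass.commutes, AlgHomClass.commutes]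
  | hg x => exact h x
  | hg' x => rw [map_star, map_star, h x]
  | hm a b ha hb => rw [map_mul, map_mul, ha, hb]
  | ha a b ha hb => rw [map_add, map_add, ha, hb]

end FreeStarAlgebra

/-- The C*-seminorms on the free *-algebra that vanish on the set `R` of relators. -/
def relationSeminorms {X : Type*} (R : Set (FreeStarAlgebra X)) :
    Set (CStarSeminorm (FreeStarAlgebra X)) :=
  {p | ∀ r ∈ R, p r = 0}

/-- The generators and relations `⟨X | R⟩` are bounded if the generators are uniformly bounded in
all C*-seminorms that vanish on `R`. This is the condition under which the universal C*-algebra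
exists. -/
def BoundedRelations {X : Type*} (R : Set (FreeStarAlgebra X)) : Prop :=
  ∀ x, ∃ C, ∀ p ∈ relationSeminorms R, p (FreeStarAlgebra.gen x) ≤ C

lemma BoundedRelations.bounded {X : Type*} {R : Set (FreeStarAlgebra X)} (h : BoundedRelations R)
    (a : FreeStarAlgebra X) : ∃ C, ∀ p ∈ relationSeminorms R, p a ≤ C := by
  have one_le : ∀ p : CStarSeminorm (FreeStarAlgebra X), p 1 ≤ 1 := fun p => by
    have h1 := p.star_mul_self 1
    rw [star_one, mul_one] at h1
    nlinarith [apply_nonneg p.toSeminorm 1]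
  induction a using FreeStarAlgebra.induction with
  | hs c =>
    refine ⟨‖c‖, fun p _ => ?_⟩
    rw [Algebra.algebraMap_eq_smul_one, map_smul_eq_mul]
    exact mul_le_of_le_one_right (norm_nonneg c) (one_le p)
  | hg x => exact h x
  | hg' x =>
    obtain ⟨C, hC⟩ := h x
    exact ⟨C, fun p hp => (p.map_star' _).trans_le (hC p hp)⟩
  | hm a b ha hb =>
    obtain ⟨C, hC⟩ := ha
    obtain ⟨D, hD⟩ := hb
    refine ⟨C * D, fun p hp => (p.mul_le a b).trans ?_⟩
    have h0 := apply_nonneg p.toSeminorm a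
    have h1 := apply_nonneg p.toSeminorm b
    exact mul_le_mul (hC p hp) (hD p hp) h1 (h0.trans (hC p hp))
  | ha a b ha hb =>
    obtain ⟨C, hC⟩ := ha
    obtain ⟨D, hD⟩ := hb
    exact ⟨C + D, fun p hp => (map_add_le_add p.toSeminorm a b).trans
      (add_le_add (hC p hp) (hD p hp))⟩

/-- The largest C*-seminorm on the free *-algebra that vanishes on the relators `R`. -/
def universalSeminorm {X : Type*} (R : Set (FreeStarAlgebra X)) (h : BoundedRelations R) :
    CStarSeminorm (FreeStarAlgebra X) :=
  CStarSeminorm.sup (relationSeminorms R) h.bounded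

/-- The universal unital C*-algebra with generators `X` and relations `r = 0`, `r ∈ R`: the
completion of the free *-algebra in the largest C*-seminorm that vanishes on `R`. -/
abbrev UniversalCStarAlgebra {X : Type*} (R : Set (FreeStarAlgebra X)) (h : BoundedRelations R) :
    Type _ :=
  (universalSeminorm R h).CStarCompletion

namespace UniversalCStarAlgebra

variable {X : Type*} {R : Set (FreeStarAlgebra X)} (h : BoundedRelations R)

/-- The quotient map from the free *-algebra. -/
def mk : FreeStarAlgebra X →⋆ₐ[ℂ] UniversalCStarAlgebra R h := (universalSeminorm R h).coe

lemma mk_relator {r : FreeStarAlgebra X} (hr : r ∈ R) : mk h r = 0 := by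
  refine ((universalSeminorm R h).coe_eq_zero_iff r).2
    (le_antisymm ?_ (apply_nonneg (universalSeminorm R h).toSeminorm r))
  exact CStarSeminorm.sup_le le_rfl fun p hp => (hp r hr).le

variable {B : Type*} [CStarAlgebra B]

lemma norm_lift_le (f : X → B) (hf : ∀ r ∈ R, FreeStarAlgebra.lift f r = 0)
    (a : FreeStarAlgebra X) : ‖FreeStarAlgebra.lift f a‖ ≤ universalSeminorm R h a :=
  CStarSeminorm.le_sup (p := CStarSeminorm.ofHom (FreeStarAlgebra.lift f))
    (fun r hr => by simp [hf r hr]) a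

/-- The universal property: a map `f : X → B` into a C*-algebra that satisfies the relations
extends to a *-homomorphism. -/
def lift (f : X → B) (hf : ∀ r ∈ R, FreeStarAlgebra.lift f r = 0) :
    UniversalCStarAlgebra R h →⋆ₐ[ℂ] B :=
  (universalSeminorm R h).lift (FreeStarAlgebra.lift f) (norm_lift_le h f hf)

lemma lift_mk (f : X → B) (hf : ∀ r ∈ R, FreeStarAlgebra.lift f r = 0) (a : FreeStarAlgebra X) :
    lift h f hf (mk h a) = FreeStarAlgebra.lift f a :=
  (universalSeminorm R h).lift_coe _ _ a

end UniversalCStarAlgebra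

/-! ### The half-liberated unitary quantum group: the C*-algebra -/

/-- A matrix `v` over a *-ring is a half-liberated biunitary if `v` and its transpose are unitary
and `a b* c = c b* a` for all entries `a, b, c` of `v`. -/
structure IsHalfLiberatedBiunitary {N : ℕ} {B : Type*} [Ring B] [StarRing B]
    (v : Matrix (Fin N) (Fin N) B) : Prop where
  unitary : v ∈ unitary (Matrix (Fin N) (Fin N) B)
  transpose_unitary : v.transpose ∈ _root_.unitary (Matrix (Fin N) (Fin N) B)
  half : ∀ i j k l m n, v i j * star (v k l) * v m n = v m n * star (v k l) * v i j

namespace HalfLiberated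

variable (N : ℕ)

/-- The matrix of generators of the free *-algebra on `N ^ 2` letters. -/
def freeMatrix : Matrix (Fin N) (Fin N) (FreeStarAlgebra (Fin N × Fin N)) :=
  Matrix.of fun i j => FreeStarAlgebra.gen (i, j)

/-- The relators expressing that the matrix of generators is a half-liberated biunitary. -/
def relators : Set (FreeStarAlgebra (Fin N × Fin N)) :=
  {r | ∃ i j, r = (freeMatrix N * star (freeMatrix N) - 1) i j} ∪
  {r | ∃ i j, r = (star (freeMatrix N) * freeMatrix N - 1) i j} ∪
  {r | ∃ i j, r = ((freeMatrix N).transpose * star (freeMatrix N).transpose - 1) i j} ∪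
  {r | ∃ i j, r = (star (freeMatrix N).transpose * (freeMatrix N).transpose - 1) i j} ∪
  {r | ∃ i j k l m n,
    r = freeMatrix N i j * star (freeMatrix N k l) * freeMatrix N m n -
      freeMatrix N m n * star (freeMatrix N k l) * freeMatrix N i j}

variable {N}

/-- A *-homomorphism kills the relators iff it sends the generators to a half-liberated
biunitary. -/
lemma kills_relators_iff {B : Type*} [Ring B] [StarRing B] [Algebra ℂ B]
    (φ : FreeStarAlgebra (Fin N × Fin N) →⋆ₐ[ℂ] B) :
    (∀ r ∈ relators N, φ r = 0) ↔
      IsHalfLiberatedBiunitary (Matrix.of fun i j => φ (FreeStarAlgebra.gen (i, j))) := by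
  constructor
  · intro h
    refine ⟨Unitary.mem_iff.2 ⟨?_, ?_⟩, Unitary.mem_iff.2 ⟨?_, ?_⟩, fun i j k l m n => ?_⟩
    · ext i j
      have := h _ (Or.inl <| Or.inl <| Or.inl <| Or.inr ⟨i, j, rfl⟩)
      simpa [Matrix.mul_apply, freeMatrix, Matrix.one_apply, apply_ite φ, sub_eq_zero, map_star]
        using this
    · ext i j
      have := h _ (Or.inl <| Or.inl <| Or.inl <| Or.inl ⟨i, j, rfl⟩)
      simpa [Matrix.mul_apply, freeMatrix, Matrix.one_apply, apply_ite φ, sub_eq_zero, map_star]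
        using this
    · ext i j
      have := h _ (Or.inl <| Or.inr ⟨i, j, rfl⟩)
      simpa [Matrix.mul_apply, freeMatrix, Matrix.one_apply, apply_ite φ, sub_eq_zero, map_star]
        using this
    · ext i j
      have := h _ (Or.inl <| Or.inl <| Or.inr ⟨i, j, rfl⟩)
      simpa [Matrix.mul_apply, freeMatrix, Matrix.one_apply, apply_ite φ, sub_eq_zero, map_star]
        using this
    · have := h _ (Or.inr ⟨i, j, k, l, m, n, rfl⟩)
      simpa [freeMatrix, sub_eq_zero, map_star] using this
  · rintro ⟨⟨h1, h2⟩, ⟨h3, h4⟩, h5⟩ r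
      ((((⟨i, j, rfl⟩ | ⟨i, j, rfl⟩) | ⟨i, j, rfl⟩) | ⟨i, j, rfl⟩) | ⟨i, j, k, l, m, n, rfl⟩)
    · have := congrFun (congrFun h2 i) j
      simpa [Matrix.mul_apply, freeMatrix, Matrix.one_apply, apply_ite φ, sub_eq_zero, map_star]
        using this
    · have := congrFun (congrFun h1 i) j
      simpa [Matrix.mul_apply, freeMatrix, Matrix.one_apply, apply_ite φ, sub_eq_zero, map_star]
        using this
    · have := congrFun (congrFun h4 i) j
      simpa [Matrix.mul_apply, freeMatrix, Matrix.one_apply, apply_ite φ, sub_eq_zero, map_star]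
        using this
    · have := congrFun (congrFun h3 i) j
      simpa [Matrix.mul_apply, freeMatrix, Matrix.one_apply, apply_ite φ, sub_eq_zero, map_star]
        using this
    · simpa [freeMatrix, sub_eq_zero, map_star] using h5 i j k l m n

/-- The entries of a unitary matrix over a C*-algebra are contractions. -/
lemma norm_entry_le_one {B : Type*} [CStarAlgebra B] {v : Matrix (Fin N) (Fin N) B}
    (hv : v ∈ unitary (Matrix (Fin N) (Fin N) B)) (i j : Fin N) : ‖v i j‖ ≤ 1 := by
  let _ : PartialOrder B := CStarAlgebra.spectralOrder B
  have _ : StarOrderedRing B := CStarAlgebra.spectralOrderedRing B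
  have h1 : ∑ k, v i k * star (v i k) = 1 := by
    have := congrFun (congrFun (Unitary.mem_iff.1 hv).2 i) i
    simpa [Matrix.mul_apply] using this
  have h2 : v i j * star (v i j) ≤ 1 := by
    rw [← h1]
    exact Finset.single_le_sum (f := fun k => v i k * star (v i k))
      (fun k _ => mul_star_self_nonneg _) (Finset.mem_univ j)
  have h3 := CStarAlgebra.norm_le_norm_of_nonneg_of_le (mul_star_self_nonneg (v i j)) h2
  rw [CStarRing.norm_self_mul_star] at h3
  have h4 : ‖(1 : B)‖ ≤ 1 := by
    rcases subsingleton_or_nontrivial B with _ | _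
    · simp [Subsingleton.elim (1 : B) 0]
    · exact CStarRing.norm_one.le
  nlinarith [norm_nonneg (v i j)]

lemma boundedRelations : BoundedRelations (relators N) := by
  rintro ⟨i, j⟩
  refine ⟨1, fun p hp => ?_⟩
  have h := (kills_relators_iff p.coe).1 fun r hr => (p.coe_eq_zero_iff r).2 (hp r hr)
  rw [← p.norm_coe]
  exact norm_entry_le_one h.unitary i j

end HalfLiberated

/-- The C*-algebra `A_u^*(N)`: the universal unital C*-algebra generated by the entries of an
`N × N` half-liberated biunitary. -/
abbrev AuStar (N : ℕ) : Type :=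
  UniversalCStarAlgebra (HalfLiberated.relators N) HalfLiberated.boundedRelations

namespace AuStar

variable {N : ℕ}

/-- The generators `u_{ij}` of `A_u^*(N)`. -/
def u (i j : Fin N) : AuStar N :=
  UniversalCStarAlgebra.mk HalfLiberated.boundedRelations (FreeStarAlgebra.gen (i, j))

lemma isHalfLiberatedBiunitary_u : IsHalfLiberatedBiunitary (Matrix.of (u (N := N))) :=
  (HalfLiberated.kills_relators_iff _).1 fun _ hr => UniversalCStarAlgebra.mk_relator _ hr

variable {B : Type*} [CStarAlgebra B]

/-- The universal property of `A_u^*(N)`: a half-liberated biunitary `v` over a C*-algebra `B`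
induces a *-homomorphism `A_u^*(N) → B`, `u_{ij} ↦ v_{ij}`. -/
def lift (v : Matrix (Fin N) (Fin N) B) (hv : IsHalfLiberatedBiunitary v) : AuStar N →⋆ₐ[ℂ] B :=
  UniversalCStarAlgebra.lift HalfLiberated.boundedRelations (fun x => v x.1 x.2)
    ((HalfLiberated.kills_relators_iff _).2 (by simp only [FreeStarAlgebra.lift_gen]; exact hv))

@[simp] lemma lift_u (v : Matrix (Fin N) (Fin N) B) (hv : IsHalfLiberatedBiunitary v)
    (i j : Fin N) : lift v hv (u i j) = v i j :=
  (UniversalCStarAlgebra.lift_mk _ _ _ _).trans (FreeStarAlgebra.lift_gen _ _)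

end AuStar

/-! ### The minimal (spatial) tensor product of C*-algebras -/

namespace MinTensor

section operators

variable {H K : Type*} [NormedAddCommGroup H] [InnerProductSpace ℂ H]
  [NormedAddCommGroup K] [InnerProductSpace ℂ K]

/-- The Hilbert space tensor product of `H` and `K`: the completion of the algebraic one. -/
def HilbertTensor (H K : Type*) [NormedAddCommGroup H] [InnerProductSpace ℂ H]
    [NormedAddCommGroup K] [InnerProductSpace ℂ K] : Type _ :=
  UniformSpace.Completion (H ⊗[ℂ] K)

instance : NormedAddCommGroup (HilbertTensor H K) :=
  inferInstanceAs (NormedAddCommGroup (UniformSpace.Completion (H ⊗[ℂ] K)))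

instance : InnerProductSpace ℂ (HilbertTensor H K) :=
  inferInstanceAs (InnerProductSpace ℂ (UniformSpace.Completion (H ⊗[ℂ] K)))

instance : CompleteSpace (HilbertTensor H K) :=
  inferInstanceAs (CompleteSpace (UniformSpace.Completion (H ⊗[ℂ] K)))

/-- The inclusion of the algebraic tensor product into the Hilbert space tensor product. -/
def toHilbert : H ⊗[ℂ] K →ₗᵢ[ℂ] HilbertTensor H K :=
  (UniformSpace.Completion.toComplₗᵢ : H ⊗[ℂ] K →ₗᵢ[ℂ] UniformSpace.Completion (H ⊗[ℂ] K))

lemma denseRange_toHilbert : DenseRange (toHilbert (H := H) (K := K)) :=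
  UniformSpace.Completion.denseRange_coe

/-- The tensor product `S ⊗ T` of bounded operators, on the Hilbert space tensor product. -/
def opTensor (S : H →L[ℂ] H) (T : K →L[ℂ] K) : HilbertTensor H K →L[ℂ] HilbertTensor H K :=
  ContinuousLinearMap.extend (toHilbert.toContinuousLinearMap ∘L TensorProduct.mapL S T)
    toHilbert.toContinuousLinearMap

lemma opTensor_coe (S : H →L[ℂ] H) (T : K →L[ℂ] K) (x : H ⊗[ℂ] K) :
    opTensor S T (toHilbert x) = toHilbert (TensorProduct.mapL S T x) := by
  have hd : DenseRange (toHilbert (H := H) (K := K)).toContinuousLinearMap := denseRange_toHilbert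
  have hi : IsUniformInducing (toHilbert (H := H) (K := K)).toContinuousLinearMap :=
    (toHilbert (H := H) (K := K)).isometry.isUniformInducing
  have h := ContinuousLinearMap.extend_eq
    (toHilbert.toContinuousLinearMap ∘L TensorProduct.mapL S T) hd hi x
  exact h

lemma op_ext {S T : HilbertTensor H K →L[ℂ] HilbertTensor H K}
    (h : ∀ x : H ⊗[ℂ] K, S (toHilbert x) = T (toHilbert x)) : S = T := by
  ext y
  exact denseRange_toHilbert.induction_on y (isClosed_eq S.continuous T.continuous) h

lemma opTensor_add_left (S S' : H →L[ℂ] H) (T : K →L[ℂ] K) :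
    opTensor (S + S') T = opTensor S T + opTensor S' T :=
  op_ext fun x => by
    simp [opTensor_coe, TensorProduct.map_add_left]

lemma opTensor_add_right (S : H →L[ℂ] H) (T T' : K →L[ℂ] K) :
    opTensor S (T + T') = opTensor S T + opTensor S T' :=
  op_ext fun x => by
    simp [opTensor_coe, TensorProduct.map_add_right]

lemma opTensor_smul_left (c : ℂ) (S : H →L[ℂ] H) (T : K →L[ℂ] K) :
    opTensor (c • S) T = c • opTensor S T :=
  op_ext fun x => by
    simp [opTensor_coe, TensorProduct.map_smul_left]

lemma opTensor_smul_right (c : ℂ) (S : H →L[ℂ] H) (T : K →L[ℂ] K) :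
    opTensor S (c • T) = c • opTensor S T :=
  op_ext fun x => by
    simp [opTensor_coe, TensorProduct.map_smul_right]

lemma opTensor_mul (S S' : H →L[ℂ] H) (T T' : K →L[ℂ] K) :
    opTensor (S * S') (T * T') = opTensor S T * opTensor S' T' :=
  op_ext fun x => by
    rw [opTensor_coe, TensorProduct.mapL_mul, mul_apply_eq_comp,
      mul_apply_eq_comp, opTensor_coe, opTensor_coe]

lemma opTensor_one : opTensor (1 : H →L[ℂ] H) (1 : K →L[ℂ] K) = 1 :=
  op_ext fun x => by
    rw [opTensor_coe, one_apply_eq_self]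
    exact congrArg _ (congrArg (fun f : H ⊗[ℂ] K →L[ℂ] H ⊗[ℂ] K => f x) TensorProduct.mapL_id_id)

lemma opTensor_star [CompleteSpace H] [CompleteSpace K] (S : H →L[ℂ] H) (T : K →L[ℂ] K) :
    opTensor (star S) (star T) = star (opTensor S T) := by
  rw [ContinuousLinearMap.star_eq_adjoint (opTensor S T), ContinuousLinearMap.eq_adjoint_iff]
  intro y z
  refine denseRange_toHilbert.induction_on₂ (p := fun y z =>
    inner ℂ (opTensor (star S) (star T) y) z = inner ℂ y (opTensor S T z))
    (isClosed_eq (by fun_prop) (by fun_prop)) (fun x w => ?_) y z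
  rw [opTensor_coe, opTensor_coe, LinearIsometry.inner_map_map, LinearIsometry.inner_map_map]
  induction x using TensorProduct.induction_on with
  | zero => simp
  | add x x' h h' => simp only [map_add, inner_add_left, h, h']
  | tmul a b =>
    induction w using TensorProduct.induction_on with
    | zero => simp
    | add x x' h h' => simp only [map_add, inner_add_right, h, h']
    | tmul c d =>
      simp [ContinuousLinearMap.star_eq_adjoint, ContinuousLinearMap.adjoint_inner_left]

lemma norm_opTensor_le (S : H →L[ℂ] H) (T : K →L[ℂ] K) : ‖opTensor S T‖ ≤ ‖S‖ * ‖T‖ := by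
  refine ContinuousLinearMap.opNorm_le_bound _ (by positivity) fun y => ?_
  refine denseRange_toHilbert.induction_on y (isClosed_le (by fun_prop) (by fun_prop)) fun x => ?_
  rw [opTensor_coe, LinearIsometry.norm_map, LinearIsometry.norm_map]
  exact (ContinuousLinearMap.le_opNorm _ _).trans
      (mul_le_mul_of_nonneg_right (TensorProduct.norm_mapL_le S T) (norm_nonneg _))

end operators

variable {A B : Type*} [CStarAlgebra A] [CStarAlgebra B]
  {H K : Type*} [NormedAddCommGroup H] [InnerProductSpace ℂ H] [CompleteSpace H]
  [NormedAddCommGroup K] [InnerProductSpace ℂ K] [CompleteSpace K]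

/-- The tensor product `π ⊗ ρ` of two representations, on the algebraic tensor product:
`a ⊗ b ↦ π a ⊗ ρ b`. -/
def tensorRep (π : A →⋆ₐ[ℂ] (H →L[ℂ] H)) (ρ : B →⋆ₐ[ℂ] (K →L[ℂ] K)) :
    A ⊗[ℂ] B →⋆ₐ[ℂ] (HilbertTensor H K →L[ℂ] HilbertTensor H K) where
  __ := Algebra.TensorProduct.algHomOfLinearMapTensorProduct
    (TensorProduct.lift (LinearMap.mk₂ ℂ (fun a b => opTensor (π a) (ρ b))
      (fun a a' b => by rw [map_add, opTensor_add_left])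
      (fun c a b => by rw [map_smul, opTensor_smul_left])
      (fun a b b' => by rw [map_add, opTensor_add_right])
      (fun c a b => by rw [map_smul, opTensor_smul_right])))
    (fun a a' b b' => by simp [opTensor_mul]) (by simp [opTensor_one])
  map_star' x := by
    induction x using TensorProduct.induction_on with
    | zero => simp
    | tmul a b => exact (congrArg₂ opTensor (map_star π a) (map_star ρ b)).trans (opTensor_star _ _)
    | add x y hx hy => simp_all

@[simp] lemma tensorRep_tmul (π : A →⋆ₐ[ℂ] (H →L[ℂ] H)) (ρ : B →⋆ₐ[ℂ] (K →L[ℂ] K)) (a : A)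
    (b : B) : tensorRep π ρ (a ⊗ₜ b) = opTensor (π a) (ρ b) := rfl

end MinTensor

universe w

/-- The C*-seminorms `x ↦ ‖(π ⊗ ρ)(x)‖` on the algebraic tensor product, where `π` and `ρ` run
through all representations of `A` and `B` on Hilbert spaces. -/
def spatialSeminorms (A B : Type w) [CStarAlgebra A] [CStarAlgebra B] :
    Set (CStarSeminorm (A ⊗[ℂ] B)) :=
  {p | ∃ (H : Type w) (_ : NormedAddCommGroup H) (_ : InnerProductSpace ℂ H) (_ : CompleteSpace H)
    (K : Type w) (_ : NormedAddCommGroup K) (_ : InnerProductSpace ℂ K) (_ : CompleteSpace K)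
    (π : A →⋆ₐ[ℂ] (H →L[ℂ] H)) (ρ : B →⋆ₐ[ℂ] (K →L[ℂ] K)),
    p = CStarSeminorm.ofHom (MinTensor.tensorRep π ρ)}

lemma spatialSeminorms_bounded {A B : Type w} [CStarAlgebra A] [CStarAlgebra B] (x : A ⊗[ℂ] B) :
    ∃ C, ∀ p ∈ spatialSeminorms A B, p x ≤ C := by
  induction x using TensorProduct.induction_on with
  | zero => exact ⟨0, fun p _ => (map_zero p.toSeminorm).le⟩
  | tmul a b =>
    refine ⟨‖a‖ * ‖b‖, ?_⟩
    rintro _ ⟨H, _, _, _, K, _, _, _, π, ρ, rfl⟩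
    exact (MinTensor.norm_opTensor_le _ _).trans
      (mul_le_mul (NonUnitalStarAlgHom.norm_apply_le π a) (NonUnitalStarAlgHom.norm_apply_le ρ b)
        (norm_nonneg _) (norm_nonneg _))
  | add x y hx hy =>
    obtain ⟨C, hC⟩ := hx
    obtain ⟨D, hD⟩ := hy
    exact ⟨C + D, fun p hp => (map_add_le_add p.toSeminorm x y).trans
      (add_le_add (hC p hp) (hD p hp))⟩

/-- The minimal (spatial) C*-norm on the algebraic tensor product. -/
def minSeminorm (A B : Type w) [CStarAlgebra A] [CStarAlgebra B] : CStarSeminorm (A ⊗[ℂ] B) :=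
  CStarSeminorm.sup (spatialSeminorms A B) spatialSeminorms_bounded

/-- The minimal (spatial) tensor product of two C*-algebras. -/
abbrev MinTensor (A B : Type w) [CStarAlgebra A] [CStarAlgebra B] : Type w :=
  (minSeminorm A B).CStarCompletion

namespace MinTensor

variable {A B A' B' : Type w} [CStarAlgebra A] [CStarAlgebra B] [CStarAlgebra A']
  [CStarAlgebra B']

/-- The inclusion of the algebraic tensor product. -/
def ofAlg : A ⊗[ℂ] B →⋆ₐ[ℂ] MinTensor A B := (minSeminorm A B).coe

/-- Elementary tensors. -/
def tmul (a : A) (b : B) : MinTensor A B := ofAlg (a ⊗ₜ[ℂ] b)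

/-- The algebraic tensor product of two *-homomorphisms. -/
def algMap (f : A →⋆ₐ[ℂ] A') (g : B →⋆ₐ[ℂ] B') : A ⊗[ℂ] B →⋆ₐ[ℂ] A' ⊗[ℂ] B' where
  __ := Algebra.TensorProduct.map f.toAlgHom g.toAlgHom
  map_star' x := by
    induction x using TensorProduct.induction_on with
    | zero => simp
    | tmul a b => simp [map_star]
    | add x y hx hy => simp_all

@[simp] lemma algMap_tmul (f : A →⋆ₐ[ℂ] A') (g : B →⋆ₐ[ℂ] B') (a : A) (b : B) :
    algMap f g (a ⊗ₜ b) = f a ⊗ₜ g b := rfl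

lemma norm_ofAlg_algMap_le (f : A →⋆ₐ[ℂ] A') (g : B →⋆ₐ[ℂ] B') (x : A ⊗[ℂ] B) :
    ‖(ofAlg.comp (algMap f g)) x‖ ≤ minSeminorm A B x := by
  refine ((minSeminorm A' B').norm_coe _).trans_le ?_
  refine CStarSeminorm.sup_le (apply_nonneg (minSeminorm A B).toSeminorm x) ?_
  rintro _ ⟨H, _, _, _, K, _, _, _, π, ρ, rfl⟩
  have h : ∀ y : A ⊗[ℂ] B,
      tensorRep π ρ (algMap f g y) = tensorRep (π.comp f) (ρ.comp g) y := fun y => by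
    induction y using TensorProduct.induction_on with
    | zero => simp
    | tmul a b => rfl
    | add x y hx hy => simp only [map_add, hx, hy]
  have hm : CStarSeminorm.ofHom (tensorRep (π.comp f) (ρ.comp g)) ∈ spatialSeminorms A B :=
    ⟨H, _, _, _, K, _, _, _, _, _, rfl⟩
  have h' := CStarSeminorm.le_sup (hS := spatialSeminorms_bounded) hm x
  rw [CStarSeminorm.ofHom_apply, ← h] at h'
  exact h'

/-- The tensor product `f ⊗ g` of two *-homomorphisms, on the minimal tensor products. -/
def map (f : A →⋆ₐ[ℂ] A') (g : B →⋆ₐ[ℂ] B') : MinTensor A B →⋆ₐ[ℂ] MinTensor A' B' :=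
  (minSeminorm A B).lift (ofAlg.comp (algMap f g)) (norm_ofAlg_algMap_le f g)

@[simp] lemma map_tmul (f : A →⋆ₐ[ℂ] A') (g : B →⋆ₐ[ℂ] B') (a : A) (b : B) :
    map f g (tmul a b) = tmul (f a) (g b) :=
  (minSeminorm A B).lift_coe _ _ _

end MinTensor

namespace MinTensor

variable {A B : Type w} [CStarAlgebra A] [CStarAlgebra B]

lemma tmul_mul_tmul (a a' : A) (b b' : B) : tmul a b * tmul a' b' = tmul (a * a') (b * b') := by
  rw [tmul, tmul, ← map_mul, Algebra.TensorProduct.tmul_mul_tmul, tmul]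

lemma star_tmul (a : A) (b : B) : star (tmul a b) = tmul (star a) (star b) := by
  rw [tmul, ← map_star, TensorProduct.star_tmul, tmul]

/-- The *-homomorphism `a ↦ a ⊗ 1`. -/
def inl : A →⋆ₐ[ℂ] MinTensor A B :=
  ofAlg.comp
    { Algebra.TensorProduct.includeLeft with
      map_star' := fun a => by simp }

/-- The *-homomorphism `b ↦ 1 ⊗ b`. -/
def inr : B →⋆ₐ[ℂ] MinTensor A B :=
  ofAlg.comp
    { (Algebra.TensorProduct.includeRight : B →ₐ[ℂ] A ⊗[ℂ] B) with
      map_star' := fun a => by simp }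

lemma inl_mul_inr (a : A) (b : B) : inl a * inr b = tmul a b :=
  (tmul_mul_tmul a 1 1 b).trans (by rw [mul_one, one_mul])

lemma inr_mul_inl (a : A) (b : B) : inr b * inl a = tmul a b :=
  (tmul_mul_tmul 1 a b 1).trans (by rw [mul_one, one_mul])

end MinTensor

/-! ### The half-liberated unitary quantum group: the coproduct -/

lemma Matrix.map_mem_unitary {N : ℕ} {B C : Type*} [Ring B] [StarRing B] [Algebra ℂ B] [Ring C]
    [StarRing C] [Algebra ℂ C] (φ : B →⋆ₐ[ℂ] C) {v : Matrix (Fin N) (Fin N) B}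
    (hv : v ∈ unitary (Matrix (Fin N) (Fin N) B)) :
    v.map φ ∈ unitary (Matrix (Fin N) (Fin N) C) := by
  have hs : star (v.map φ) = (star v).map φ := by
    ext i j
    simp [map_star]
  rw [Unitary.mem_iff] at hv ⊢
  rw [hs, ← Matrix.map_mul, ← Matrix.map_mul, hv.1, hv.2]
  simp

namespace AuStar

variable {N : ℕ}

/-- The matrix with entries `∑ k, u_{ik} ⊗ u_{kj}`. -/
def comulMatrix (N : ℕ) : Matrix (Fin N) (Fin N) (MinTensor (AuStar N) (AuStar N)) :=
  Matrix.of fun i j => ∑ k, MinTensor.tmul (u i k) (u k j)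

lemma isHalfLiberatedBiunitary_comulMatrix : IsHalfLiberatedBiunitary (comulMatrix N) where
  unitary := by
    have h : comulMatrix N =
        (Matrix.of (u (N := N))).map MinTensor.inl * (Matrix.of (u (N := N))).map MinTensor.inr := by
      ext i j
      simp [comulMatrix, Matrix.mul_apply, MinTensor.inl_mul_inr]
    rw [h]
    exact mul_mem (Matrix.map_mem_unitary _ isHalfLiberatedBiunitary_u.unitary)
      (Matrix.map_mem_unitary _ isHalfLiberatedBiunitary_u.unitary)
  transpose_unitary := by
    have h : (comulMatrix N).transpose =
        (Matrix.of (u (N := N))).transpose.map MinTensor.inr *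
          (Matrix.of (u (N := N))).transpose.map MinTensor.inl := by
      ext i j
      simp [comulMatrix, Matrix.mul_apply, MinTensor.inr_mul_inl]
    rw [h]
    exact mul_mem (Matrix.map_mem_unitary _ isHalfLiberatedBiunitary_u.transpose_unitary)
      (Matrix.map_mem_unitary _ isHalfLiberatedBiunitary_u.transpose_unitary)
  half i j k l m n := by
    have key : ∀ i j m n : Fin N,
        comulMatrix N i j * star (comulMatrix N k l) * comulMatrix N m n =
          ∑ x, ∑ y, ∑ z, MinTensor.tmul (u i z * star (u k y) * u m x)
            (u z j * star (u y l) * u x n) := fun i j m n => by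
      simp [comulMatrix, Finset.sum_mul, Finset.mul_sum, star_sum, MinTensor.star_tmul,
        MinTensor.tmul_mul_tmul]
    have hh := (isHalfLiberatedBiunitary_u (N := N)).half
    simp only [Matrix.of_apply] at hh
    rw [key, key, Finset.sum_comm]
    conv_rhs => rw [Finset.sum_comm]
    refine Finset.sum_congr rfl fun y _ => ?_
    rw [Finset.sum_comm]
    refine Finset.sum_congr rfl fun z _ => Finset.sum_congr rfl fun x _ => ?_
    rw [hh i z k y m x, hh z j y l x n]

/-- The coproduct of `A_u^*(N)`: the *-homomorphism with
`Δ(u_{ij}) = ∑ k, u_{ik} ⊗ u_{kj}`. -/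
def comul (N : ℕ) : AuStar N →⋆ₐ[ℂ] MinTensor (AuStar N) (AuStar N) :=
  lift (comulMatrix N) isHalfLiberatedBiunitary_comulMatrix

lemma comul_u (i j : Fin N) : comul N (u i j) = ∑ k, MinTensor.tmul (u i k) (u k j) :=
  lift_u _ _ i j

/-- The C*-algebra `PA_u^*(N)` of the projective version: the (closed, unital) C*-subalgebra of
`A_u^*(N)` generated by the products `u_{ij}* u_{kl}`. -/
def projective (N : ℕ) : StarSubalgebra ℂ (AuStar N) :=
  (StarAlgebra.adjoin ℂ {x | ∃ i j k l : Fin N, x = star (u i j) * u k l}).topologicalClosure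

instance (N : ℕ) : IsClosed (projective N : Set (AuStar N)) :=
  StarSubalgebra.isClosed_topologicalClosure _

end AuStar

/-- The C*-algebra `PA_u^*(N)` of the projective version of the half-liberated unitary group. -/
abbrev PAuStar (N : ℕ) : Type := AuStar.projective N

/-- The inclusion `PA_u^*(N) ⊆ A_u^*(N)`. -/
def PAuStar.incl (N : ℕ) : PAuStar N →⋆ₐ[ℂ] AuStar N := (AuStar.projective N).subtype

/-! ### Commutative examples: `C(X) ⊗ C(Y) = C(X × Y)` and compact groups -/

namespace MinTensor

section commutative

variable {X Y : Type} [TopologicalSpace X] [CompactSpace X]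
  [TopologicalSpace Y] [CompactSpace Y]

/-- The canonical map on the algebraic tensor product:
`f ⊗ g ↦ ((x, y) ↦ f x * g y)`. -/
def algToContinuous : C(X, ℂ) ⊗[ℂ] C(Y, ℂ) →⋆ₐ[ℂ] C(X × Y, ℂ) where
  __ := Algebra.TensorProduct.productMap
    (ContinuousMap.compStarAlgHom' ℂ ℂ (ContinuousMap.fst : C(X × Y, X))).toAlgHom
    (ContinuousMap.compStarAlgHom' ℂ ℂ (ContinuousMap.snd : C(X × Y, Y))).toAlgHom
  map_star' z := by
    change Algebra.TensorProduct.productMap _ _ (star z) =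
      star (Algebra.TensorProduct.productMap _ _ z)
    induction z using TensorProduct.induction_on with
    | zero => simp
    | tmul f g => ext; simp
    | add x y hx hy => rw [star_add, map_add, map_add, star_add, hx, hy]

lemma algToContinuous_tmul (f : C(X, ℂ)) (g : C(Y, ℂ)) (x : X) (y : Y) :
    algToContinuous (f ⊗ₜ g) (x, y) = f x * g y := by
  have h : algToContinuous (f ⊗ₜ g) = (f.comp ContinuousMap.fst : C(X × Y, ℂ)) *
      (g.comp ContinuousMap.snd : C(X × Y, ℂ)) :=
    Algebra.TensorProduct.productMap_apply_tmul _ _ f g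
  rw [h]
  rfl

/-- Evaluation at a point, as a representation on `ℂ`. -/
def evalRep {X : Type} [TopologicalSpace X] (x : X) : C(X, ℂ) →⋆ₐ[ℂ] (ℂ →L[ℂ] ℂ) :=
  (StarAlgHom.ofId ℂ (ℂ →L[ℂ] ℂ)).comp (ContinuousMap.evalStarAlgHom ℂ ℂ x)

lemma evalRep_apply {X : Type} [TopologicalSpace X] (x : X) (f : C(X, ℂ)) (c : ℂ) : evalRep x f c = f x * c := by
  change (algebraMap ℂ (ℂ →L[ℂ] ℂ) (f x)) c = _
  simp [Algebra.algebraMap_eq_smul_one]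

lemma tensorRep_eval (x : X) (y : Y) (z : C(X, ℂ) ⊗[ℂ] C(Y, ℂ)) :
    tensorRep (evalRep x) (evalRep y) z (toHilbert ((1 : ℂ) ⊗ₜ[ℂ] (1 : ℂ))) =
      algToContinuous z (x, y) • toHilbert ((1 : ℂ) ⊗ₜ[ℂ] (1 : ℂ)) := by
  induction z using TensorProduct.induction_on with
  | zero => simp
  | tmul f g =>
    rw [algToContinuous_tmul, tensorRep_tmul, opTensor_coe, TensorProduct.mapL_tmul,
      evalRep_apply, evalRep_apply, ← map_smul, mul_one, mul_one]
    congr 1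
    rw [← mul_one (f x), ← mul_one (g y), ← smul_eq_mul (f x), ← smul_eq_mul (g y),
      TensorProduct.smul_tmul_smul]
    simp
  | add a b ha hb => simp only [map_add, ContinuousMap.add_apply, add_smul, ← ha, ← hb]; rfl

lemma norm_algToContinuous_le (z : C(X, ℂ) ⊗[ℂ] C(Y, ℂ)) :
    ‖algToContinuous z‖ ≤ minSeminorm C(X, ℂ) C(Y, ℂ) z := by
  rw [ContinuousMap.norm_le _ (apply_nonneg (minSeminorm C(X, ℂ) C(Y, ℂ)).toSeminorm z)]
  rintro ⟨x, y⟩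
  have hm : CStarSeminorm.ofHom (tensorRep (evalRep x) (evalRep y)) ∈
      spatialSeminorms C(X, ℂ) C(Y, ℂ) := ⟨ℂ, _, _, inferInstance, ℂ, _, _, inferInstance, _, _, rfl⟩
  refine le_trans ?_ (CStarSeminorm.le_sup (hS := spatialSeminorms_bounded) hm z)
  have h := ContinuousLinearMap.le_opNorm (tensorRep (evalRep x) (evalRep y) z)
    (toHilbert ((1 : ℂ) ⊗ₜ[ℂ] (1 : ℂ)))
  rw [tensorRep_eval, norm_smul, LinearIsometry.norm_map, TensorProduct.norm_tmul] at h
  simpa using h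

/-- The canonical *-homomorphism `C(X) ⊗ C(Y) → C(X × Y)`,
`f ⊗ g ↦ ((x, y) ↦ f x * g y)`. -/
def toContinuous : MinTensor C(X, ℂ) C(Y, ℂ) →⋆ₐ[ℂ] C(X × Y, ℂ) :=
  (minSeminorm C(X, ℂ) C(Y, ℂ)).lift algToContinuous norm_algToContinuous_le

lemma toContinuous_ofAlg (z : C(X, ℂ) ⊗[ℂ] C(Y, ℂ)) :
    toContinuous (ofAlg z) = algToContinuous z :=
  (minSeminorm C(X, ℂ) C(Y, ℂ)).lift_coe _ _ z

lemma toContinuous_tmul (f : C(X, ℂ)) (g : C(Y, ℂ)) (x : X) (y : Y) :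
    toContinuous (tmul f g) (x, y) = f x * g y := by
  rw [tmul, toContinuous_ofAlg, algToContinuous_tmul]

lemma denseRange_ofAlg {A B : Type w} [CStarAlgebra A] [CStarAlgebra B] :
    DenseRange (ofAlg : A ⊗[ℂ] B →⋆ₐ[ℂ] MinTensor A B) :=
  (minSeminorm A B).denseRange_coe

lemma mul_comm_of_continuous (a b : MinTensor C(X, ℂ) C(Y, ℂ)) : a * b = b * a :=
  (denseRange_ofAlg (A := C(X, ℂ)) (B := C(Y, ℂ))).induction_on₂
    (p := fun a b => a * b = b * a) (isClosed_eq (by fun_prop) (by fun_prop))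
    (fun x y => by rw [← map_mul, mul_comm x y, map_mul]) a b

/-- The tensor product of commutative C*-algebras `C(X)` and `C(Y)` is commutative. -/
abbrev commCStarAlgebra : CommCStarAlgebra (MinTensor C(X, ℂ) C(Y, ℂ)) where
  __ := (inferInstance : CStarAlgebra (MinTensor C(X, ℂ) C(Y, ℂ)))
  mul_comm := mul_comm_of_continuous

variable [T2Space X] [T2Space Y]

lemma exists_apply_ne {x x' : X} (h : x ≠ x') : ∃ f : C(X, ℂ), f x ≠ f x' := by
  by_contra! hf
  exact h ((WeakDual.CharacterSpace.continuousMapEval_bijective (X := X) (𝕜 := ℂ)).1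
    (DFunLike.ext _ _ hf))

/-- A unital complex-valued character of `C(X)` is the evaluation at a point. -/
lemma exists_eval (χ : C(X, ℂ) →⋆ₐ[ℂ] ℂ) : ∃ x, ∀ f, χ f = f x := by
  have hc : Continuous χ := (AddMonoidHomClass.continuous_of_bound χ 1 fun f => by
    rw [one_mul]; exact NonUnitalStarAlgHom.norm_apply_le χ f)
  let ψ : WeakDual.characterSpace ℂ C(X, ℂ) :=
    WeakDual.CharacterSpace.equivAlgHom.symm χ.toAlgHom
  obtain ⟨x, hx⟩ := (WeakDual.CharacterSpace.continuousMapEval_bijective (X := X) (𝕜 := ℂ)).2 ψ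
  refine ⟨x, fun f => ?_⟩
  have := congrArg (fun φ : WeakDual.characterSpace ℂ C(X, ℂ) => φ f) hx
  exact this.symm

lemma norm_ofAlg_le (z : C(X, ℂ) ⊗[ℂ] C(Y, ℂ)) : ‖ofAlg z‖ ≤ ‖algToContinuous z‖ := by
  let _ : CommCStarAlgebra (MinTensor C(X, ℂ) C(Y, ℂ)) := commCStarAlgebra
  have hg := (gelfandTransform_isometry (MinTensor C(X, ℂ) C(Y, ℂ))).norm_map_of_map_zero
    (map_zero _) (ofAlg z)
  rw [← hg, ContinuousMap.norm_le _ (norm_nonneg _)]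
  intro χ
  let χ' : MinTensor C(X, ℂ) C(Y, ℂ) →⋆ₐ[ℂ] ℂ :=
    { WeakDual.CharacterSpace.toAlgHom χ with map_star' := fun a => map_star χ a }
  obtain ⟨x, hx⟩ := exists_eval (χ'.comp inl)
  obtain ⟨y, hy⟩ := exists_eval (χ'.comp inr)
  have h : ∀ w : C(X, ℂ) ⊗[ℂ] C(Y, ℂ), χ' (ofAlg w) = algToContinuous w (x, y) := fun w => by
    induction w using TensorProduct.induction_on with
    | zero => simp
    | tmul f g =>
      rw [algToContinuous_tmul, ← hx, ← hy]
      change χ' (tmul f g) = χ' (inl f) * χ' (inr g)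
      rw [← map_mul, inl_mul_inr]
    | add a b ha hb => rw [map_add, map_add, map_add, ha, hb, ContinuousMap.add_apply]
  change ‖χ' (ofAlg z)‖ ≤ _
  rw [h]
  exact ContinuousMap.norm_coe_le_norm _ _

lemma norm_toContinuous (a : MinTensor C(X, ℂ) C(Y, ℂ)) : ‖toContinuous a‖ = ‖a‖ := by
  have hc : Continuous (toContinuous (X := X) (Y := Y)) :=
    (minSeminorm C(X, ℂ) C(Y, ℂ)).continuous_lift _ _
  refine denseRange_ofAlg.induction_on a (isClosed_eq hc.norm continuous_norm) fun z => ?_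
  rw [toContinuous_ofAlg]
  exact le_antisymm
    ((norm_algToContinuous_le z).trans ((minSeminorm C(X, ℂ) C(Y, ℂ)).norm_coe z).ge)
    (norm_ofAlg_le z)

lemma toContinuous_bijective : Function.Bijective (toContinuous (X := X) (Y := Y)) := by
  have hi : Isometry (toContinuous (X := X) (Y := Y)) :=
    AddMonoidHomClass.isometry_of_norm _ norm_toContinuous
  refine ⟨hi.injective, fun f => ?_⟩
  have hcl : IsClosed (Set.range (toContinuous (X := X) (Y := Y))) :=
    hi.isClosedEmbedding.isClosed_range
  have hsep : (toContinuous (X := X) (Y := Y)).range.SeparatesPoints := by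
    rintro ⟨x, y⟩ ⟨x', y'⟩ hne
    by_cases h : x = x'
    · obtain ⟨g, hg⟩ := exists_apply_ne (fun h' => hne (by rw [h, h']) : y ≠ y')
      refine ⟨_, ⟨toContinuous (tmul 1 g), ⟨tmul 1 g, rfl⟩, rfl⟩, ?_⟩
      simpa [toContinuous_tmul] using hg
    · obtain ⟨f, hf⟩ := exists_apply_ne h
      refine ⟨_, ⟨toContinuous (tmul f 1), ⟨tmul f 1, rfl⟩, rfl⟩, ?_⟩
      simpa [toContinuous_tmul] using hf
  have htop := ContinuousMap.starSubalgebra_topologicalClosure_eq_top_of_separatesPoints _ hsep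
  have hf : f ∈ (toContinuous (X := X) (Y := Y)).range.topologicalClosure := by
    rw [htop]; trivial
  have hf' : f ∈ closure (Set.range (toContinuous (X := X) (Y := Y))) := hf
  rwa [hcl.closure_eq] at hf'

/-- The canonical isomorphism `C(X) ⊗ C(Y) ≃ C(X × Y)` for compact Hausdorff spaces. -/
def continuousEquiv : MinTensor C(X, ℂ) C(Y, ℂ) ≃⋆ₐ[ℂ] C(X × Y, ℂ) :=
  StarAlgEquiv.ofBijective toContinuous toContinuous_bijective

end commutative

end MinTensor

/-- The coproduct of `C(G)` for a compact group `G`: `(Δ f)(g, h) = f (g h)`, under the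
identification `C(G × G) = C(G) ⊗ C(G)`. -/
def compactGroupComul (G : Type) [TopologicalSpace G] [CompactSpace G] [T2Space G] [Group G]
    [IsTopologicalGroup G] : C(G, ℂ) →⋆ₐ[ℂ] MinTensor C(G, ℂ) C(G, ℂ) :=
  (MinTensor.continuousEquiv (X := G) (Y := G)).symm.toStarAlgHom.comp
    (ContinuousMap.compStarAlgHom' ℂ ℂ ⟨fun g : G × G => g.1 * g.2, continuous_mul⟩)

/-! ### The projective unitary group -/

instance unitaryGroup_compactSpace (N : ℕ) : CompactSpace (Matrix.unitaryGroup (Fin N) ℂ) := by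
  refine isCompact_iff_compactSpace.1 ?_
  refine IsCompact.of_isClosed_subset (s := Set.pi Set.univ fun _ : Fin N =>
    Set.pi Set.univ fun _ : Fin N => Metric.closedBall (0 : ℂ) 1)
    (isCompact_univ_pi fun _ => isCompact_univ_pi fun _ => isCompact_closedBall _ _) ?_ ?_
  · have h : ((Matrix.unitaryGroup (Fin N) ℂ : Submonoid (Matrix (Fin N) (Fin N) ℂ)) :
        Set (Matrix (Fin N) (Fin N) ℂ)) = {A | A * star A = 1} := by
      ext A
      exact Matrix.mem_unitaryGroup_iff
    rw [h]
    exact isClosed_eq (by fun_prop) continuous_const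
  · intro A hA i _ j _
    rw [mem_closedBall_zero_iff]
    exact entry_norm_bound_of_unitary hA i j

/-- The subgroup of scalar matrices in `U(N)`. -/
def scalarUnitary (N : ℕ) : Subgroup (Matrix.unitaryGroup (Fin N) ℂ) where
  carrier := {g | ∃ c : ℂ, (g : Matrix (Fin N) (Fin N) ℂ) = c • 1}
  one_mem' := ⟨1, by simp⟩
  mul_mem' := by
    rintro a b ⟨c, hc⟩ ⟨d, hd⟩
    exact ⟨c * d, by simp [hc, hd, smul_smul, mul_comm]⟩
  inv_mem' := by
    rintro a ⟨c, hc⟩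
    refine ⟨star c, ?_⟩
    change star (a : Matrix (Fin N) (Fin N) ℂ) = _
    rw [hc, star_smul, star_one]

instance (N : ℕ) : (scalarUnitary N).Normal := by
  refine ⟨fun g => ?_⟩
  rintro ⟨c, hc⟩ h
  refine ⟨c, ?_⟩
  have : (h : Matrix (Fin N) (Fin N) ℂ) * star (h : Matrix (Fin N) (Fin N) ℂ) = 1 :=
    (Unitary.mem_iff.1 h.2).2
  change (h : Matrix (Fin N) (Fin N) ℂ) * g * star (h : Matrix (Fin N) (Fin N) ℂ) = _
  rw [hc, mul_smul_comm, smul_mul_assoc, mul_one, this]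

instance (N : ℕ) : IsClosed (scalarUnitary N : Set (Matrix.unitaryGroup (Fin N) ℂ)) := by
  have h : (scalarUnitary N : Set (Matrix.unitaryGroup (Fin N) ℂ)) =
      Subtype.val ⁻¹' (Submodule.span ℂ {(1 : Matrix (Fin N) (Fin N) ℂ)} :
        Set (Matrix (Fin N) (Fin N) ℂ)) := by
    ext g
    simp [scalarUnitary, Submodule.mem_span_singleton, eq_comm]
  rw [h]
  exact (Submodule.closed_of_finiteDimensional _).preimage continuous_subtype_val

/-- The projective unitary group `PU(N) = U(N) / U(1)`. -/
abbrev PU (N : ℕ) : Type := Matrix.unitaryGroup (Fin N) ℂ ⧸ scalarUnitary N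

end

noncomputable section

open scoped TensorProduct ComplexOrder

universe w

/-! Write a, b, c, d for generators `u i j`. The relation ab*c = cb*a and its adjoint a*bc* = c*ba*
give a*b·c*d = c*b·a*d = c*d·a*b, so the products a*b commute (`star_mul_comm`), and by continuity
so does the closed algebra they generate. By Gelfand theory this algebra is then governed by its
characters.

Every g in U(N) gives a character a*b ↦ conj(g_a) g_b, because `AuStar N` maps onto the coordinate
functions of U(N). This character depends only on the class of g modulo scalars, which yields
`toPU`. Conversely, let χ be a character and P_ab = χ(a*b). Half-liberation also gives a*b·c*d =
a*d·c*b (`star_mul_exchange`), so P_ab P_cd = P_ad P_cb: the Hermitian matrix P has rank at most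
one. Unitarity of u provides a positive diagonal entry, hence P_ab = conj(v_a) v_b for a vector v,
and unitarity again says that v, arranged as a square matrix, lies in U(N) (`exists_evalUnitary`).
So the characters are exactly the points of PU(N): `toPU` is isometric, and it is onto by
Stone–Weierstrass, since the numbers conj(g_a) g_b determine g up to a scalar (`PU.mk_eq_mk_iff`).

The coproduct of the projective version is defined by transport along this isomorphism, which makes
the compatibility with Φ formal and avoids having to show that `AuStar.comul` takes values in the
image of ι ⊗ ι and that ι ⊗ ι is injective. What remains is that it restricts `AuStar.comul`. This
is checked on the products a*b, where both sides are the same explicit double sum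
(`map_incl_comul`). -/

lemma StarAlgHom.continuous_of_cstarAlgebra {A B : Type*} [CStarAlgebra A] [CStarAlgebra B]
    (f : A →⋆ₐ[ℂ] B) : Continuous f :=
  AddMonoidHomClass.continuous_of_bound f 1 fun x => by
    rw [one_mul]
    exact NonUnitalStarAlgHom.norm_apply_le f x

/-! ### Uniqueness and functoriality for maps of minimal tensor products. -/

namespace MinTensor

variable {A B A' B' A'' B'' : Type w} [CStarAlgebra A] [CStarAlgebra B] [CStarAlgebra A']
  [CStarAlgebra B'] [CStarAlgebra A''] [CStarAlgebra B'']

/-- *-homomorphisms out of the minimal tensor product agree if they agree on elementary tensors. -/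
lemma hom_ext {C : Type*} [CStarAlgebra C] {f g : MinTensor A B →⋆ₐ[ℂ] C}
    (h : ∀ a b, f (tmul a b) = g (tmul a b)) : f = g := by
  refine (minSeminorm A B).hom_ext f.continuous_of_cstarAlgebra g.continuous_of_cstarAlgebra
    fun z => ?_
  change f (ofAlg z) = g (ofAlg z)
  induction z using TensorProduct.induction_on with
  | zero => simp
  | tmul a b => exact h a b
  | add x y hx hy => rw [map_add, map_add, map_add, hx, hy]

/-- Together with `map_id` this cancels Φ ⊗ Φ against Φ⁻¹ ⊗ Φ⁻¹ in `map_equivPU_comul`. -/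
lemma map_map (f : A →⋆ₐ[ℂ] A') (g : B →⋆ₐ[ℂ] B') (f' : A' →⋆ₐ[ℂ] A'') (g' : B' →⋆ₐ[ℂ] B'')
    (z : MinTensor A B) : map f' g' (map f g z) = map (f'.comp f) (g'.comp g) z := by
  have h : (map f' g').comp (map f g) = map (f'.comp f) (g'.comp g) :=
    hom_ext fun a b => by simp
  exact congrArg (fun F => F z) h

lemma map_id (z : MinTensor A B) : map (StarAlgHom.id ℂ A) (StarAlgHom.id ℂ B) z = z := by
  have h : map (StarAlgHom.id ℂ A) (StarAlgHom.id ℂ B) = StarAlgHom.id ℂ _ :=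
    hom_ext fun a b => by simp
  exact congrArg (fun F => F z) h

end MinTensor

/-! ### Commutativity and relations of the projective version. -/

namespace PAuStar

open AuStar

variable {N : ℕ}

lemma half (i j k l m n : Fin N) :
    u i j * star (u k l) * u m n = u m n * star (u k l) * u i j :=
  isHalfLiberatedBiunitary_u.half i j k l m n

lemma star_half (i j k l m n : Fin N) :
    star (u i j) * u k l * star (u m n) = star (u m n) * u k l * star (u i j) := by
  have h := congrArg star (half m n k l i j)
  simpa [mul_assoc] using h

/-- The products `u_{ij}* u_{kl}` commute with each other. -/
lemma star_mul_comm (i j k l i' j' k' l' : Fin N) :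
    star (u i j) * u k l * (star (u i' j') * u k' l') =
      star (u i' j') * u k' l' * (star (u i j) * u k l) := by
  -- With factors a*, b, c*, d: `star_half` exchanges the outer terms of a*bc*, then `half`
  -- exchanges those of ba*d.
  rw [← mul_assoc, star_half, mul_assoc, mul_assoc, ← mul_assoc (u k l), half, mul_assoc, mul_assoc]

/-- Products of two generators of `PA_u^*(N)` are symmetric in the second factors. -/
lemma star_mul_exchange (i j k l i' j' k' l' : Fin N) :
    star (u i j) * u k l * (star (u i' j') * u k' l') =
      star (u i j) * u k' l' * (star (u i' j') * u k l) := by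
  rw [mul_assoc, ← mul_assoc (u k l), half, mul_assoc, mul_assoc]

protected lemma mul_comm (x y : PAuStar N) : x * y = y * x := by
  have h : ∀ a ∈ {x : AuStar N | ∃ i j k l : Fin N, x = star (u i j) * u k l},
      ∀ b ∈ {x : AuStar N | ∃ i j k l : Fin N, x = star (u i j) * u k l}, a * b = b * a := by
    rintro _ ⟨i, j, k, l, rfl⟩ _ ⟨i', j', k', l', rfl⟩
    exact star_mul_comm ..
  -- The generators must also commute with adjoints of generators; the adjoint of a*b is b*a, again
  -- a generator.
  have hc := StarAlgebra.isMulCommutative_adjoin ℂ h (by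
    rintro a ha _ ⟨i, j, k, l, rfl⟩
    exact h a ha _ ⟨k, l, i, j, by simp⟩)
  let _ := StarSubalgebra.commRingTopologicalClosure _ hc.is_comm.comm
  exact mul_comm (G := (StarAlgebra.adjoin ℂ
    {x : AuStar N | ∃ i j k l : Fin N, x = star (u i j) * u k l}).topologicalClosure) x y

/-- The commutative C*-algebra structure of `PA_u^*(N)`. -/
abbrev commCStarAlgebra (N : ℕ) : CommCStarAlgebra (PAuStar N) where
  __ := (inferInstance : CStarAlgebra (PAuStar N))
  mul_comm := PAuStar.mul_comm

/-- The generator `u_{ij}* u_{kl}` of `PA_u^*(N)`. -/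
def gen (i j k l : Fin N) : PAuStar N :=
  ⟨star (u i j) * u k l,
    StarSubalgebra.le_topologicalClosure _ (StarAlgebra.subset_adjoin ℂ _ ⟨i, j, k, l, rfl⟩)⟩

@[simp] lemma incl_gen (i j k l : Fin N) : incl N (gen i j k l) = star (u i j) * u k l := rfl

lemma star_gen (i j k l : Fin N) : star (gen i j k l) = gen k l i j :=
  Subtype.ext (by simp [gen])

/-- Under a character this becomes the vanishing of all 2 × 2 minors of the matrix (χ(a*b)), i.e.
rank at most one. -/
lemma gen_mul_gen (i j k l i' j' k' l' : Fin N) :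
    gen i j k l * gen i' j' k' l' = gen i j k' l' * gen i' j' k l :=
  Subtype.ext (star_mul_exchange ..)

/-- The entries of u*u = 1. This is the only trace of unitarity needed to analyse characters: it
keeps χ(a*b) from vanishing identically and later makes the matrix v unitary. -/
lemma sum_gen (j l : Fin N) : ∑ i, gen i j i l = if j = l then 1 else 0 := by
  have h := congrFun (congrFun (Unitary.mem_iff.1
    (isHalfLiberatedBiunitary_u (N := N)).unitary).1 j) l
  apply Subtype.ext
  rw [AddSubmonoidClass.coe_finsetSum]
  simpa [Matrix.mul_apply, Matrix.one_apply, gen, apply_ite Subtype.val] using h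

/-- *-homomorphisms out of `PA_u^*(N)` agree if they agree on the products `u_{ij}* u_{kl}`. -/
lemma hom_ext {B : Type*} [CStarAlgebra B] {f g : PAuStar N →⋆ₐ[ℂ] B}
    (h : ∀ i j k l, f (gen i j k l) = g (gen i j k l)) : f = g := by
  refine StarAlgHom.ext_topologicalClosure f.continuous_of_cstarAlgebra
    g.continuous_of_cstarAlgebra (StarAlgHom.ext_adjoin ?_)
  rintro ⟨_, hx⟩ ⟨i, j, k, l, rfl⟩
  exact h i j k l

end PAuStar

/-! ### The abelianization onto functions on U(N). -/

namespace AuStar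

variable {N : ℕ}

/-- The coordinate functions of `U(N)`, as a matrix over `C(U(N))`. -/
def coordMatrix (N : ℕ) : Matrix (Fin N) (Fin N) C(Matrix.unitaryGroup (Fin N) ℂ, ℂ) :=
  Matrix.of fun i j => ⟨fun g => g.1 i j, continuous_subtype_val.matrix_elem i j⟩

lemma coordMatrix_apply (i j : Fin N) (g : Matrix.unitaryGroup (Fin N) ℂ) :
    coordMatrix N i j g = g.1 i j := rfl

/-- Pointwise, unitarity is that of each g. Since C(U(N)) is commutative, half-liberation is
automatic and transposition reverses products, so the transpose is unitary as well. -/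
lemma isHalfLiberatedBiunitary_coordMatrix : IsHalfLiberatedBiunitary (coordMatrix N) := by
  have h1 : star (coordMatrix N) * coordMatrix N = 1 := by
    ext i j g
    have h := congrFun (congrFun (Unitary.mem_iff.1 g.2).1 i) j
    simpa [Matrix.mul_apply, coordMatrix_apply, Matrix.one_apply,
      apply_ite (fun f : C(Matrix.unitaryGroup (Fin N) ℂ, ℂ) => f g)] using h
  have h2 : coordMatrix N * star (coordMatrix N) = 1 := by
    ext i j g
    have h := congrFun (congrFun (Unitary.mem_iff.1 g.2).2 i) j
    simpa [Matrix.mul_apply, coordMatrix_apply, Matrix.one_apply,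
      apply_ite (fun f : C(Matrix.unitaryGroup (Fin N) ℂ, ℂ) => f g)] using h
  have h3 : star (coordMatrix N).transpose = (star (coordMatrix N)).transpose := rfl
  refine ⟨Unitary.mem_iff.2 ⟨h1, h2⟩, Unitary.mem_iff.2 ⟨?_, ?_⟩, fun i j k l m n => by ring⟩
  · rw [h3, ← Matrix.transpose_mul, h2, Matrix.transpose_one]
  · rw [h3, ← Matrix.transpose_mul, h1, Matrix.transpose_one]

/-- The abelianization map `A_u^*(N) → C(U(N))`. -/
def toUnitary (N : ℕ) : AuStar N →⋆ₐ[ℂ] C(Matrix.unitaryGroup (Fin N) ℂ, ℂ) :=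
  lift (coordMatrix N) isHalfLiberatedBiunitary_coordMatrix

@[simp] lemma toUnitary_u (i j : Fin N) : toUnitary N (u i j) = coordMatrix N i j :=
  lift_u _ _ i j

end AuStar

/-! ### When two unitary matrices have the same class in PU(N). -/

lemma mem_scalarUnitary_iff {N : ℕ} {g : Matrix.unitaryGroup (Fin N) ℂ} :
    g ∈ scalarUnitary N ↔ ∃ c : ℂ, (g : Matrix (Fin N) (Fin N) ℂ) = c • 1 := Iff.rfl

namespace PU

variable {N : ℕ}

/-- No condition |c| = 1 is required: g*h = c·1 is already a unitary matrix, and `scalarUnitary`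
asks only for some complex scalar. -/
lemma mk_eq_mk_of_smul {g h : Matrix.unitaryGroup (Fin N) ℂ} {c : ℂ}
    (hc : (h : Matrix (Fin N) (Fin N) ℂ) = c • (g : Matrix (Fin N) (Fin N) ℂ)) :
    (g : PU N) = h := by
  refine QuotientGroup.eq.2 (mem_scalarUnitary_iff.2 ⟨c, ?_⟩)
  change star (g : Matrix (Fin N) (Fin N) ℂ) * h = _
  rw [hc, mul_smul_comm, (Unitary.mem_iff.1 g.2).1]

/-- A vector is determined up to phase by the products conj(g_a) g_b. One direction makes evaluation
well defined on PU(N), the other separates its points. -/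
lemma mk_eq_mk_iff {g h : Matrix.unitaryGroup (Fin N) ℂ} : (g : PU N) = h ↔
    ∀ i j k l, star (g.1 i j) * g.1 k l = star (h.1 i j) * h.1 k l := by
  constructor
  · intro e
    obtain ⟨c, hc⟩ := mem_scalarUnitary_iff.1 (QuotientGroup.eq.1 e)
    have hh : h.1 = c • g.1 := by
      change star g.1 * h.1 = _ at hc
      rw [← one_mul h.1, ← (Unitary.mem_iff.1 g.2).2, mul_assoc, hc, mul_smul_comm, mul_one]
    intro i j k l
    -- Comparing h*h = 1 with g*g = 1 gives conj(c) c · 1 = 1; the index i at hand supplies a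
    -- diagonal entry from which to read this off (for N = 0 there is none).
    have hcc : star c * c = 1 := by
      have h1 : star h.1 * h.1 = 1 := (Unitary.mem_iff.1 h.2).1
      rw [hh, star_smul, smul_mul_smul_comm, (Unitary.mem_iff.1 g.2).1] at h1
      simpa using congrFun (congrFun h1 i) i
    simp only [hh, Matrix.smul_apply, smul_eq_mul, star_mul']
    linear_combination (-(star (g.1 i j) * g.1 k l)) * hcc
  · intro e
    by_cases h0 : ∃ i j, g.1 i j ≠ 0
    · obtain ⟨i, j, hij⟩ := h0
      have hs : star (h.1 i j) ≠ 0 := by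
        intro h0
        have := e i j i j
        rw [h0, zero_mul, mul_eq_zero, star_eq_zero, or_self] at this
        exact hij this
      -- The constant solves conj(g_ij) g_kl = conj(h_ij) h_kl for h_kl.
      refine mk_eq_mk_of_smul (c := star (g.1 i j) / star (h.1 i j)) ?_
      ext k l
      rw [Matrix.smul_apply, smul_eq_mul, div_mul_eq_mul_div, eq_div_iff hs, e i j k l, mul_comm]
    -- If all entries of g vanish then 1 = g*g = 0 (so N = 0), and all matrices coincide.
    · push Not at h0
      have hz : g.1 = 0 := Matrix.ext h0
      have h1 : (1 : Matrix (Fin N) (Fin N) ℂ) = 0 := by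
        rw [← (Unitary.mem_iff.1 g.2).1, hz, mul_zero]
      refine mk_eq_mk_of_smul (c := 1) ?_
      rw [← mul_one h.1, ← mul_one g.1, h1, mul_zero, mul_zero, smul_zero]

end PU

/-! ### Evaluation at unitary matrices and the map to C(PU(N)). -/

namespace PAuStar

open AuStar

variable {N : ℕ}

/-- Evaluation of an element of `PA_u^*(N)` at a unitary matrix. -/
def evalUnitary (g : Matrix.unitaryGroup (Fin N) ℂ) : PAuStar N →⋆ₐ[ℂ] ℂ :=
  (ContinuousMap.evalStarAlgHom ℂ ℂ g).comp ((toUnitary N).comp (incl N))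

lemma evalUnitary_apply (g : Matrix.unitaryGroup (Fin N) ℂ) (x : PAuStar N) :
    evalUnitary g x = toUnitary N (incl N x) g := rfl

lemma evalUnitary_gen (g : Matrix.unitaryGroup (Fin N) ℂ) (i j k l : Fin N) :
    evalUnitary g (gen i j k l) = star (g.1 i j) * g.1 k l := by
  rw [evalUnitary_apply, incl_gen, map_mul, map_star, toUnitary_u, toUnitary_u]
  rfl

lemma evalUnitary_eq {g h : Matrix.unitaryGroup (Fin N) ℂ} (e : (g : PU N) = h) :
    evalUnitary g = evalUnitary h :=
  hom_ext fun i j k l => by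
    rw [evalUnitary_gen, evalUnitary_gen, PU.mk_eq_mk_iff.1 e]

/-- The canonical *-homomorphism `PA_u^*(N) → C(PU(N))`. -/
def toPU (N : ℕ) : PAuStar N →⋆ₐ[ℂ] C(PU N, ℂ) where
  toFun x :=
    { toFun := Quotient.lift (fun g => evalUnitary g x) fun _ _ e =>
        congrArg (fun f => f x) (evalUnitary_eq (Quotient.sound e))
      continuous_toFun := Continuous.quotient_lift (toUnitary N (incl N x)).continuous _ }
  map_one' := by
    ext ⟨g⟩
    exact map_one (evalUnitary g)
  map_mul' x y := by
    ext ⟨g⟩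
    exact map_mul (evalUnitary g) x y
  map_zero' := by
    ext ⟨g⟩
    exact map_zero (evalUnitary g)
  map_add' x y := by
    ext ⟨g⟩
    exact map_add (evalUnitary g) x y
  commutes' c := by
    ext ⟨g⟩
    exact AlgHomClass.commutes (evalUnitary g) c
  map_star' x := by
    ext ⟨g⟩
    exact map_star (evalUnitary g) x

lemma toPU_mk (x : PAuStar N) (g : Matrix.unitaryGroup (Fin N) ℂ) :
    toPU N x (g : PU N) = evalUnitary g x := rfl

lemma toPU_gen (i j k l : Fin N) (g : Matrix.unitaryGroup (Fin N) ℂ) :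
    toPU N (gen i j k l) (g : PU N) = star (g.1 i j) * g.1 k l :=
  evalUnitary_gen g i j k l

/-! ### Characters of the projective version, and bijectivity of `toPU`. -/

/-- A matrix of numbers of rank one with the symmetries of `(conj g_a * g_b)` is of this form. -/
lemma exists_rank_one {ι : Type*} (P : ι → ι → ℂ) (hs : ∀ a b, star (P a b) = P b a)
    (hr : ∀ a b c d, P a b * P c d = P a d * P c b) {a : ι} (ha : 0 < P a a) :
    ∃ v : ι → ℂ, ∀ b c, P b c = star (v b) * v c := by
  obtain ⟨r, hr0, hra⟩ : ∃ r : ℝ, 0 < r ∧ (r : ℂ) * r = P a a := by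
    obtain ⟨h1, h2⟩ := Complex.pos_iff.1 ha
    refine ⟨√(P a a).re, Real.sqrt_pos.2 h1, ?_⟩
    rw [← Complex.ofReal_mul, Real.mul_self_sqrt h1.le]
    exact Complex.ext rfl h2
  have hr' : (r : ℂ) ≠ 0 := Complex.ofReal_ne_zero.2 hr0.ne'
  -- The vector is row a divided by the square root r of the pivot P_aa. Then conj(v_b) v_c = P_ba
  -- P_ac / P_aa, which is P_bc by the rank-one relation.
  refine ⟨fun b => P a b / r, fun b c => ?_⟩
  have hrs : star (r : ℂ) = r := Complex.conj_ofReal r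
  rw [star_div₀, hs, hrs, div_mul_div_comm, hra, eq_div_iff ha.ne', hr b c a a, mul_comm]

/-- Every character of `PA_u^*(N)` is the evaluation at a unitary matrix. -/
lemma exists_evalUnitary (χ : PAuStar N →⋆ₐ[ℂ] ℂ) : ∃ g, χ = evalUnitary g := by
  have hsum (j l : Fin N) : ∑ i, χ (gen i j i l) = if j = l then 1 else 0 := by
    rw [← map_sum, sum_gen, apply_ite χ, map_one, map_zero]
  obtain ⟨v, hv⟩ : ∃ v : Fin N × Fin N → ℂ,
      ∀ b c, χ (gen b.1 b.2 c.1 c.2) = star (v b) * v c := by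
    rcases isEmpty_or_nonempty (Fin N) with h | ⟨⟨j⟩⟩
    · exact ⟨0, fun b => isEmptyElim b.1⟩
    -- Pivot: the diagonal entries χ(u_ij* u_ij) of a fixed column j sum to 1, so one of them is
    -- nonzero.
    · obtain ⟨i, -, hi⟩ : ∃ i ∈ Finset.univ, χ (gen i j i j) ≠ 0 :=
        Finset.exists_ne_zero_of_sum_ne_zero (by rw [hsum, if_pos rfl]; exact one_ne_zero)
      have hs (a b : Fin N × Fin N) :
          star (χ (gen a.1 a.2 b.1 b.2)) = χ (gen b.1 b.2 a.1 a.2) := by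
        rw [← map_star, star_gen]
      have hr (a b c d : Fin N × Fin N) :
          χ (gen a.1 a.2 b.1 b.2) * χ (gen c.1 c.2 d.1 d.2) =
            χ (gen a.1 a.2 d.1 d.2) * χ (gen c.1 c.2 b.1 b.2) := by
        rw [← map_mul, ← map_mul, gen_mul_gen]
      -- With P_ab = χ(a*b), multiply P_aa by 1 = ∑ P_cc, the sum over the entries c of column j.
      -- The rank-one relation turns P_aa P_cc into P_ac P_ca = |P_ac|², so positivity needs no
      -- order on the algebra.
      have hnonneg : 0 ≤ χ (gen i j i j) := by
        have h1 : ∑ k, χ (gen k j k j) = 1 := (hsum j j).trans (if_pos rfl)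
        rw [← mul_one (χ (gen i j i j)), ← h1, Finset.mul_sum]
        refine Finset.sum_nonneg fun k _ => ?_
        rw [hr (i, j) (i, j) (k, j) (k, j), ← hs (i, j) (k, j)]
        exact mul_star_self_nonneg _
      have hpos : 0 < χ (gen i j i j) := hnonneg.lt_of_ne hi.symm
      exact exists_rank_one (ι := Fin N × Fin N) (fun a b => χ (gen a.1 a.2 b.1 b.2)) hs hr
        (a := (i, j)) hpos
  replace hv (i j k l : Fin N) : χ (gen i j k l) = star (v (i, j)) * v (k, l) :=
    hv (i, j) (k, l)
  simp only [hv] at hsum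
  have hg : Matrix.of (fun i j => v (i, j)) ∈ Matrix.unitaryGroup (Fin N) ℂ := by
    -- For a square complex matrix v*v = 1 suffices, and this is what `hsum` says.
    rw [Matrix.mem_unitaryGroup_iff']
    ext j l
    simpa [Matrix.mul_apply, Matrix.one_apply] using hsum j l
  refine ⟨⟨_, hg⟩, hom_ext fun i j k l => ?_⟩
  rw [evalUnitary_gen]
  exact hv i j k l

/-- By Gelfand, ‖x‖ is the supremum of |χ(x)| over the characters χ, and by `exists_evalUnitary`
each χ(x) is a value of `toPU N x`. The other inequality is contractivity of *-homomorphisms. -/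
lemma norm_toPU (x : PAuStar N) : ‖toPU N x‖ = ‖x‖ := by
  refine le_antisymm (NonUnitalStarAlgHom.norm_apply_le (toPU N) x) ?_
  let _ := commCStarAlgebra N
  rw [← (gelfandTransform_isometry (PAuStar N)).norm_map_of_map_zero (map_zero _) x,
    ContinuousMap.norm_le _ (norm_nonneg _)]
  intro χ
  obtain ⟨g, hg⟩ := exists_evalUnitary
    { WeakDual.CharacterSpace.toAlgHom χ with map_star' := fun a => map_star χ a }
  have h : χ x = toPU N x (g : PU N) := congrArg (fun f => f x) hg
  change ‖χ x‖ ≤ _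
  rw [h]
  exact ContinuousMap.norm_coe_le_norm _ _

/-- Isometry gives injectivity and a closed range; the range is dense by Stone–Weierstrass, as the
images of the generators already separate points. -/
lemma toPU_bijective : Function.Bijective (toPU N) := by
  have hi : Isometry (toPU N) := AddMonoidHomClass.isometry_of_norm _ norm_toPU
  refine ⟨hi.injective, fun f => ?_⟩
  have hsep : (toPU N).range.SeparatesPoints := by
    rintro ⟨g⟩ ⟨h⟩ hne
    by_contra! hall
    refine hne (PU.mk_eq_mk_iff.2 fun i j k l => ?_)
    rw [← toPU_gen, ← toPU_gen]
    exact hall _ ⟨_, ⟨gen i j k l, rfl⟩, rfl⟩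
  have hf : f ∈ closure (Set.range (toPU N)) := by
    change f ∈ (toPU N).range.topologicalClosure
    rw [ContinuousMap.starSubalgebra_topologicalClosure_eq_top_of_separatesPoints _ hsep]
    trivial
  rwa [hi.isClosedEmbedding.isClosed_range.closure_eq] at hf

/-! ### The isomorphism and the comparison of coproducts. -/

/-- The isomorphism `PA_u^*(N) ≃ C(PU(N))`. -/
def equivPU (N : ℕ) : PAuStar N ≃⋆ₐ[ℂ] C(PU N, ℂ) :=
  StarAlgEquiv.ofBijective (toPU N) toPU_bijective

lemma equivPU_gen (i j k l : Fin N) (g : Matrix.unitaryGroup (Fin N) ℂ) :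
    equivPU N (gen i j k l) (g : PU N) = star (g.1 i j) * g.1 k l :=
  toPU_gen i j k l g

/-- Under C(X) ⊗ C(Y) = C(X × Y) this is the expansion of conj((gh)_ij) (gh)_kl by the matrix
product. -/
lemma compactGroupComul_equivPU_gen (i j k l : Fin N) :
    compactGroupComul (PU N) (equivPU N (gen i j k l)) =
      ∑ a, ∑ b, MinTensor.tmul (equivPU N (gen i a k b)) (equivPU N (gen a j b l)) := by
  apply (MinTensor.continuousEquiv (X := PU N) (Y := PU N)).injective
  refine ((MinTensor.continuousEquiv (X := PU N) (Y := PU N)).apply_symm_apply _).trans ?_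
  change _ = MinTensor.toContinuous _
  ext ⟨x, y⟩
  obtain ⟨g, rfl⟩ := QuotientGroup.mk_surjective x
  obtain ⟨h, rfl⟩ := QuotientGroup.mk_surjective y
  simp only [map_sum, ContinuousMap.sum_apply, MinTensor.toContinuous_tmul]
  change equivPU N (gen i j k l) ((g * h : Matrix.unitaryGroup (Fin N) ℂ) : PU N) =
    ∑ a, ∑ b, equivPU N (gen i a k b) (g : PU N) * equivPU N (gen a j b l) (h : PU N)
  simp only [equivPU_gen, Matrix.UnitaryGroup.mul_val, Matrix.mul_apply, star_sum,
    Finset.sum_mul_sum, star_mul']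
  exact Finset.sum_congr rfl fun a _ => Finset.sum_congr rfl fun b _ => by ring

/-- The coproduct of `PA_u^*(N)`, transported from `C(PU(N))`. -/
def comul (N : ℕ) : PAuStar N →⋆ₐ[ℂ] MinTensor (PAuStar N) (PAuStar N) :=
  (MinTensor.map (equivPU N).symm.toStarAlgHom (equivPU N).symm.toStarAlgHom).comp
    ((compactGroupComul (PU N)).comp (equivPU N).toStarAlgHom)

lemma comul_apply (x : PAuStar N) :
    comul N x = MinTensor.map (equivPU N).symm.toStarAlgHom (equivPU N).symm.toStarAlgHom
      (compactGroupComul (PU N) (equivPU N x)) := rfl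

lemma comul_gen (i j k l : Fin N) :
    comul N (gen i j k l) = ∑ a, ∑ b, MinTensor.tmul (gen i a k b) (gen a j b l) := by
  have h (x : PAuStar N) : (equivPU N).symm.toStarAlgHom (equivPU N x) = x :=
    (equivPU N).symm_apply_apply x
  simp only [comul_apply, compactGroupComul_equivPU_gen, map_sum, MinTensor.map_tmul, h]

/-- The coproduct of `PA_u^*(N)` is the restriction of the coproduct of `A_u^*(N)`. -/
lemma map_incl_comul (x : PAuStar N) :
    MinTensor.map (incl N) (incl N) (comul N x) = AuStar.comul N (incl N x) := by
  -- On a generator both sides equal ∑ u_ia* u_kb ⊗ u_aj* u_bl, summed over a and b.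
  have h : (MinTensor.map (incl N) (incl N)).comp (comul N) =
      (AuStar.comul N).comp (incl N) := hom_ext fun i j k l => by
    simp only [StarAlgHom.comp_apply, comul_gen, map_sum, MinTensor.map_tmul, incl_gen, map_mul,
      map_star, comul_u, star_sum, Finset.sum_mul_sum, MinTensor.star_tmul,
      MinTensor.tmul_mul_tmul]
  exact congrArg (fun f => f x) h

/-- Holds by construction: `comul` was transported along `equivPU`, so only functoriality of the
tensor product is involved. -/
lemma map_equivPU_comul (x : PAuStar N) :
    MinTensor.map (equivPU N).toStarAlgHom (equivPU N).toStarAlgHom (comul N x) =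
      compactGroupComul (PU N) (equivPU N x) := by
  have h : (equivPU N).toStarAlgHom.comp (equivPU N).symm.toStarAlgHom =
      StarAlgHom.id ℂ C(PU N, ℂ) := StarAlgHom.ext (equivPU N).apply_symm_apply
  rw [comul_apply, MinTensor.map_map, h, MinTensor.map_id]

end PAuStar

end

theorem mainTheorem5 (N : ℕ) :
    (∀ x y : PAuStar N, x * y = y * x) ∧
    ∃ Δ : PAuStar N →⋆ₐ[ℂ] MinTensor (PAuStar N) (PAuStar N),
      (∀ x, MinTensor.map (PAuStar.incl N) (PAuStar.incl N) (Δ x) =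
        AuStar.comul N (PAuStar.incl N x)) ∧
      ∃ Φ : PAuStar N ≃⋆ₐ[ℂ] C(PU N, ℂ),
        ∀ x, compactGroupComul (PU N) (Φ x) =
          MinTensor.map Φ.toStarAlgHom Φ.toStarAlgHom (Δ x) :=
  ⟨PAuStar.mul_comm, PAuStar.comul N, PAuStar.map_incl_comul, PAuStar.equivPU N,
    fun x => (PAuStar.map_equivPU_comul x).symm⟩
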